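/- Let $k$ be a field of characteristic $0$, and let $\Lambda$ be the unital associative $k$-algebra generated by $v(n)$, $n\ge 0$, with the relations $$v(n)v(m)-3v(n-1)v(m+1)+3v(n-2)v(m+2)-v(n-3)v(m+3)=0\quad(n\ge 3,\ m\ge 0),$$ $$v(n)v(m)-v(m)v(n)=(n-m)\,v(n+m-1)\quad(n>m\ge 0),$$ augmented by $v(n)\mapsto 0$; let $\Lambda_+$ be its augmentation ideal. (Thus $\Lambda_+=\mathcal A_+(U(3))$, where $U(3)$ is the universal associative envelope, with locality bound $N=3$, of the Virasoro conformal algebra.) With respect to the deg-lex order with $v(n)>v(m)$ iff $n>m$, the leading words of the Gröbner–Shirshov basis of $\Lambda$ are $v(1)v(0)$ and $v(n)v(m)$ with $n\ge 2$, $m\ge 0$. The words containing none of these are called reduced; the nonempty reduced words form a basis of $\Lambda_+$. Let $B_n=\Lambda_+^{\otimes n}$ be the normalized bar complex of $\Lambda$ with trivial coefficients, with basis the cells $[w_1|\dots|w_n]$, where the $w_i$ are nonempty reduced words, and differential $$[w_1|\dots|w_n]\mapsto\sum_{j=1}^{n-1}(-1)^j[w_1|\dots|w_jw_{j+1}|\dots|w_n],$$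 the products being expanded in reduced words. An Anick chain is a cell $[i_1|\dots|i_n]:=[v(i_1)|\dots|v(i_n)]$ in which every $v(i_j)v(i_{j+1})$ is one of the above leading words; that is, $i_1,\dots,i_{n-2}\ge 2$, and either $i_{n-1}\ge 2$ or $(i_{n-1},i_n)=(1,0)$. Whenever $[i_1|\dots|i_r|x]$ $(r\ge 0)$ is an Anick chain and $v(x)w'$ is a reduced word with $w'$ nonempty, match the cell $[v(i_1)|\dots|v(i_r)|v(x)w'|\dots]$ with the cell $[v(i_1)|\dots|v(i_r)|v(x)|w'|\dots]$ (with the same remaining entries). This is a Morse matching whose unmatched cells are exactly the Anick chains. Let $(\mathsf A_\bullet,\delta_\bullet)$ be the corresponding Morse complex, called the Anick complex: $\mathsf A_n$ is the span of the Anick chains $[i_1|\dots|i_n]$, and the coefficient of an Anick chain $a$ in $\delta_{n+1}(b)\in\mathsf A_n$, for an Anick chain $b$ in $\mathsf A_{n+1}$, is the sum over all directed paths from $b$ to $a$ of the products of the weights of their edges, in the graph whose vertices are the cells, whose edges $c\to c'$ are weighted by the nonzero coefficients $[c:c']$ of $c'$ in the differential of $c$, and in which each matched edge $c\to c'$ is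 replaced by $c'\to c$ with weight $-1/[c:c']$. For $j\ge 0$ let $\mathsf A_{n,j}\subseteq\mathsf A_n$ be the span of the Anick chains $[i_1|\dots|i_n]$ with $i_n\ge j$. Then the following hold. 1. If $n\ge 2$, $u\in\mathsf A_{n,2}$ and $\delta_n u=0$, then $u=\delta_{n+1}w$ for some $w\in\mathsf A_{n+1,2}$. 2. If $n\ge 3$, $u\in\mathsf A_{n,1}$ and $\delta_n u=0$, then $u=\delta_{n+1}w$ for some $w\in\mathsf A_{n+1,1}$. 3. The Anick complex is exact in degrees $n\ge 4$: $\operatorname{im}(\delta_{n+1}\colon\mathsf A_{n+1}\to\mathsf A_n)=\ker(\delta_n\colon\mathsf A_n\to\mathsf A_{n-1})$ for all $n\ge 4$. -/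

import Mathlib

namespace U3

variable (k : Type*) [Field k]

/-- The defining relations between the generators `v(n)`, `n ≥ 0`: locality of order `3` and the
Virasoro commutation relations. -/
inductive Rel : FreeAlgebra k ℕ → FreeAlgebra k ℕ → Prop
  | locality (n m : ℕ) (hn : 3 ≤ n) : Rel
      (FreeAlgebra.ι k n * FreeAlgebra.ι k m
        - 3 * (FreeAlgebra.ι k (n - 1) * FreeAlgebra.ι k (m + 1))
        + 3 * (FreeAlgebra.ι k (n - 2) * FreeAlgebra.ι k (m + 2))
        - FreeAlgebra.ι k (n - 3) * FreeAlgebra.ι k (m + 3)) 0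
  | commutator (n m : ℕ) (hnm : m < n) : Rel
      (FreeAlgebra.ι k n * FreeAlgebra.ι k m - FreeAlgebra.ι k m * FreeAlgebra.ι k n)
      (((n : k) - (m : k)) • FreeAlgebra.ι k (n + m - 1))

/-- The unital algebra `Λ = 𝒜₊(U(3)) ⊕ k`. Its augmentation sends every `v(n)` to `0`. -/
abbrev Lam : Type _ := RingQuot (Rel k)

/-- The generator `v(n)` of `Λ`. -/
noncomputable def v (n : ℕ) : Lam k :=
  RingQuot.mkAlgHom k (Rel k) (FreeAlgebra.ι k n)

/-- `Obstruction n m` says that `v(n)v(m)` is a leading word of the Gröbner–Shirshov basis of `Λ`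
(deg-lex order with `v(n) > v(m)` iff `n > m`): the leading words are `v(1)v(0)` and
`v(n)v(m)` with `n ≥ 2`, `m ≥ 0`. -/
def Obstruction (n m : ℕ) : Prop := 2 ≤ n ∨ (n = 1 ∧ m = 0)

/-- Nonempty reduced words `v(n₁)⋯v(n_r)`: those that contain no leading word. -/
abbrev RWord : Type :=
  {w : List ℕ // w ≠ [] ∧ w.IsChain (fun n m => ¬ Obstruction n m)}

/-- The one-letter word `v(n)`. -/
def letter (n : ℕ) : RWord := ⟨[n], by simp, by simp⟩

theorem letter_injective : Function.Injective letter := fun _ _ h => by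
  simpa [letter] using h

/-- The element of `𝒜₊(U(3)) ⊆ Λ` represented by a reduced word. -/
noncomputable def RWord.eval (w : RWord) : Lam k := (w.1.map (v k)).prod

/-- The normal form: the (unique) linear combination of nonempty reduced words which is equal to a
given element `x` of the augmentation ideal `𝒜₊(U(3))` of `Λ`. -/
noncomputable def normalForm (x : Lam k) : RWord →₀ k :=
  Function.invFun (Finsupp.linearCombination k (RWord.eval k)) x

/-- `B_• = ⨁ₙ 𝒜₊(U(3))^{⊗ n}`, the two-sided normalized bar resolution of `Λ` tensored with the
trivial bimodule `k` over `Λᵉ`. Its basis consists of the cells `[w₁|…|wₙ]` with `wᵢ` nonempty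
reduced words; the degree of a cell is its length `n`. -/
abbrev Bar : Type _ := List RWord →₀ k

/-- The differential of the bar complex: the boundary `∑_{j=1}^{n-1} (-1)^j [w₁|…|w_j w_{j+1}|…|wₙ]` of a cell, where the product is
expanded in reduced words. (The outer faces vanish as the coefficients are trivial.) -/
noncomputable def barCellBoundary : List RWord → Bar k
  | [] => 0
  | [_] => 0
  | a :: b :: l =>
      - Finsupp.mapDomain (fun w => w :: l) (normalForm k (a.eval k * b.eval k))
      - Finsupp.mapDomain (fun c => a :: c) (barCellBoundary (b :: l))

/-- Anick chains `[i₁|…|iₙ] = [v(i₁)|…|v(iₙ)]`: each pair of neighbours is a leading word. Hence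
`i₁, …, i_{n-2} ≥ 2` and either `i_{n-1} ≥ 2` or `(i_{n-1}, iₙ) = (1, 0)`. -/
abbrev AnickChain : Type := {c : List ℕ // c.IsChain Obstruction}

/-- An Anick chain as a cell of the bar complex. -/
def AnickChain.cell (c : AnickChain) : List RWord := c.1.map letter

theorem AnickChain.cell_injective : Function.Injective AnickChain.cell := fun _ _ h =>
  Subtype.ext (List.map_injective_iff.2 letter_injective h)

/-- The Morse matching on the cells of the bar complex that produces the Anick complex. If
`[i₁|…|i_r|x]` is an Anick chain and `v(x)w'` is a reduced word with `w'` nonempty, then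
`b = [v(i₁)|…|v(i_r)|v(x)w'|…]` is matched with the cell `c = [v(i₁)|…|v(i_r)|v(x)|w'|…]`, which
has `b` as a face. The unmatched cells are precisely the Anick chains. -/
def Matched (b c : List RWord) : Prop :=
  ∃ (p : List ℕ) (x : ℕ) (w w' : RWord) (l : List RWord),
    (p ++ [x]).IsChain Obstruction ∧ w.1 = x :: w'.1 ∧
      b = p.map letter ++ w :: l ∧ c = p.map letter ++ letter x :: w' :: l

open Classical in
/-- One zigzag step from a cell `b`: go up to the cell `c` matched with `b`, along the reversed
edge of weight `-1 / [c : b]`, and then down to all the faces of `c` other than `b`. Here `[c : b]`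
is the coefficient of `b` in the boundary of `c`. The result is `0` if there is no such `c`. -/
noncomputable def zigzagCell (b : List RWord) : Bar k :=
  if h : ∃ c, Matched b c then
    - ((barCellBoundary k h.choose b)⁻¹ • (barCellBoundary k h.choose).erase b)
  else 0

/-- One zigzag step, as a linear map. -/
noncomputable def zigzag : Module.End k (Bar k) :=
  Finsupp.linearCombination k (zigzagCell k)

/-- The space of the Anick complex `A_• = A_•(Λ, Λ) ⊗_{Λᵉ} k`, spanned by the Anick chains. -/
abbrev Anick : Type _ := AnickChain →₀ k

/-- The projection of the bar complex onto the span of the Anick chains. -/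
noncomputable def proj : Bar k →ₗ[k] Anick k :=
  Finsupp.lcomapDomain AnickChain.cell AnickChain.cell_injective

/-- The differential of the Anick complex, that is, of the Morse complex of the matching. The
coefficient of `a` in the boundary of `b` is the sum of the weights of all the paths from `b` to
`a` in the graph of the bar complex with the matched edges reversed. Such a path goes down once,
and then makes `s` zigzag steps, for some `s ≥ 0`. -/
noncomputable def anickBoundary : Anick k →ₗ[k] Anick k :=
  Finsupp.linearCombination k fun b : AnickChain =>
    ∑ᶠ s : ℕ, proj k ((zigzag k ^ s) (barCellBoundary k b.cell))

/-- `A_{n,j}`: the span of the Anick chains `[i₁|…|iₙ]` with `iₙ ≥ j`. -/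
noncomputable def anickFiltration (n j : ℕ) : Submodule k (Anick k) :=
  Submodule.span k {x | ∃ c : AnickChain,
    c.1.length = n ∧ (∀ i ∈ c.1.getLast?, j ≤ i) ∧ x = Finsupp.single c 1}

/-- The component `A_n`: the span of the Anick chains `[i₁|…|iₙ]`. -/
noncomputable def anickComponent (n : ℕ) : Submodule k (Anick k) :=
  Submodule.span k {x | ∃ c : AnickChain, c.1.length = n ∧ x = Finsupp.single c 1}

end U3

/-!
The complex of Anick chains is computed inside the bar complex, and its exactness follows from the
triangularity of its differential with respect to the last letter of a chain.

**Normal forms.** For fixed `N` the function `n ↦ v(n)v(N-n)` is quadratic by locality, and the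
commutator of `v(N)` and `v(0)` determines its second difference. Hence `v(n)v(m)`, `n ≥ 2`, is a
combination of `v(0)v(N)`, `v(1)v(N-1)` and `v(N-1)`, where `N = n + m` (`v_mul_v_of_two_le`).
Reduction lowers a word in the deg-lex order, preserves its weight, where `v(i)` has weight `i - 1`,
and does not lower its last letter (`Descends`, `word_mem_span`). The reduced words are
`v(0)^A v(1)^B` and `v(0)^A v(1)^B v(N)` with `N ≥ 2`. They are linearly independent as they act
independently on the tensor densities supported at the origin (`linearCombination_eval_injective`).

**The Morse complex.** A zigzag step equals `lower + ∂ homotopy` (`zigzag_eq`) and is locally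
nilpotent, as it lowers the word spelled by a cell unless the path ends (`Matched.face`). So
`1 - zigzag` is invertible, the Anick differential is `δ = proj (1 - zigzag)⁻¹ ∂`
(`anickBoundary_eq`), and `δ² = 0` is a formal consequence (`anickBoundary_anickBoundary`).

**Exactness.** Let `a` be a combination of chains of positive degree with all letters at least two.
Merging the last letter of `a` with `m` yields only words with last letter larger than `m`
(`lastGE_of_mem_support_mulNF`), so `δ[a|m] = [δa|m]` up to chains with last letter larger than `m`
(`exists_morse_append_letter`). If `[a|m]` is the part of a cycle `u` with the smallest last letter,
then `a` is a cycle. By induction on the degree `a = δb`, and `u - δ[b|m]` has a larger smallest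
last letter; the weight bounds the last letter, so this process ends (`exact_of_append`). In degree
two, where each `[i]` is a cycle, one uses that `δ[2|m]` is a nonzero multiple of `[m+1]`: first,
each `[i]` with `i ≥ 3` is a boundary, and second, a cycle has no component `[2|m]` once its other
terms with last letter `m` are removed (`exact_two`). The same step with smallest last letter `1`
proves the second claim (`exact_one`). For the third claim one first removes the terms `[b|1|0]` of
a cycle, and then the terms `[c|0]` with all letters of `c` at least two (`exact_zero`).
-/

namespace U3

section

open Polynomial

variable (k : Type*) [Field k]

/-! ### The rewriting rules of `Λ` -/

theorem v_mul_locality (n m : ℕ) (hn : 3 ≤ n) :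
    v k n * v k m = 3 * (v k (n - 1) * v k (m + 1)) - 3 * (v k (n - 2) * v k (m + 2))
      + v k (n - 3) * v k (m + 3) := by
  have h := RingQuot.mkAlgHom_rel k (Rel.locality (k := k) n m hn)
  simp only [map_sub, map_add, map_mul, map_ofNat, map_zero] at h
  simp only [v]
  rw [← sub_eq_zero, ← h]
  abel

theorem v_commutator (n m : ℕ) (h : m < n) :
    v k n * v k m = v k m * v k n + ((n : k) - m) • v k (n + m - 1) := by
  have h := RingQuot.mkAlgHom_rel k (Rel.commutator (k := k) n m h)
  simp only [map_sub, map_mul, map_smul] at h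
  simp only [v]
  rw [← h]
  abel

/-- By locality the third differences of `n ↦ v(n)v(N-n)` vanish, hence this function is
quadratic in `n`. -/
theorem v_mul_v_eq_interpolation [CharZero k] (N n : ℕ) (hn : n ≤ N) :
    v k n * v k (N - n) = v k 0 * v k N + (n : k) • (v k 1 * v k (N - 1) - v k 0 * v k N)
      + ((n : k) * (n - 1) / 2) •
        (v k 2 * v k (N - 2) - (2 : k) • (v k 1 * v k (N - 1)) + v k 0 * v k N) := by
  induction n using Nat.strong_induction_on with
  | _ n ih =>
    match n, ih, hn with
    | 0, _, _ => simp
    | 1, _, _ => simp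
    | 2, _, _ =>
      norm_num
      module
    | n + 3, ih, hn =>
      rw [v_mul_locality k _ _ (by omega)]
      have h0 := ih n (by omega) (by omega)
      have h1 := ih (n + 1) (by omega) (by omega)
      have h2 := ih (n + 2) (by omega) (by omega)
      have e0 : N - (n + 3) + 3 = N - n := by omega
      have e1 : N - (n + 3) + 2 = N - (n + 1) := by omega
      have e2 : N - (n + 3) + 1 = N - (n + 2) := by omega
      have e3 : n + 3 - 1 = n + 2 := rfl
      have e4 : n + 3 - 2 = n + 1 := rfl
      have e5 : n + 3 - 3 = n := rfl
      have three (x : Lam k) : 3 * x = (3 : k) • x := by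
        rw [Algebra.smul_def, map_ofNat]
      rw [e0, e1, e2, e3, e4, e5, three, three, h0, h1, h2]
      push_cast
      module

/-- The rewriting rule of the leading word `v(n)v(m)`, `n ≥ 2`. -/
theorem v_mul_v_of_two_le [CharZero k] (n m : ℕ) (hn : 2 ≤ n) :
    v k n * v k m = (-((n : k) - 1) * (m - 1) / (n + m - 1)) • (v k 0 * v k (n + m))
      + ((n : k) * m / (n + m - 1)) • (v k 1 * v k (n + m - 1))
      + ((n : k) * (n - 1) / (n + m - 1)) • v k (n + m - 1) := by
  have hN : ((n : k) + m - 1) ≠ 0 := by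
    have : ((n + m - 1 : ℕ) : k) ≠ 0 := Nat.cast_ne_zero.2 (by omega)
    rwa [Nat.cast_sub (by omega), Nat.cast_add, Nat.cast_one] at this
  have hN' : ((n : k) + m) ≠ 0 := by
    rw [← Nat.cast_add]
    exact Nat.cast_ne_zero.2 (by omega)
  have h1 := v_mul_v_eq_interpolation k (n + m) n (by omega)
  have h2 := v_mul_v_eq_interpolation k (n + m) (n + m) le_rfl
  rw [Nat.add_sub_cancel_left] at h1
  rw [Nat.sub_self, v_commutator k (n + m) 0 (by omega), add_zero] at h2
  push_cast at h2
  set a := v k 0 * v k (n + m)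
  set b := v k 1 * v k (n + m - 1)
  set c := v k 2 * v k (n + m - 2) - (2 : k) • b + a
  -- the commutator of `v(n+m)` and `v(0)` determines the second difference `c`
  have hc : c = (2 / ((n : k) + m - 1)) • (v k (n + m - 1) - b + a) := by
    have h3 : ((n : k) + m) • v k (n + m - 1) = ((n : k) + m) • (b - a)
        + (((n : k) + m) * (n + m - 1) / 2) • c := by
      have h4 := congrArg (fun x => x - a) h2
      simp only [sub_zero] at h4
      rw [add_assoc] at h4
      simpa using h4
    have h5 : (((n : k) + m) * (n + m - 1) / 2) • c
        = ((n : k) + m) • (v k (n + m - 1) - b + a) := by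
      rw [← sub_eq_iff_eq_add'.2 h3]
      module
    have h6 := congrArg (fun x => (2 / (((n : k) + m) * (n + m - 1))) • x) h5
    simp only [smul_smul] at h6
    rw [show (2 / (((n : k) + m) * (n + m - 1))) * ((((n : k) + m) * (n + m - 1) / 2)) = 1 by
      field_simp, one_smul,
      show (2 / (((n : k) + m) * (n + m - 1))) * ((n : k) + m) = 2 / ((n : k) + m - 1) by
      field_simp] at h6
    exact h6
  rw [h1, hc]
  match_scalars <;> field_simp <;> ring

/-- A leading word `v(n)v(m)` is a combination of `v(0)v(n+m)`, `v(1)v(n+m-1)` and `v(n+m-1)`; the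
middle term is absent for `v(1)v(0)`. -/
theorem exists_rewriting [CharZero k] {n m : ℕ} (h : Obstruction n m) :
    ∃ a b c : k, (n < 2 → b = 0) ∧ v k n * v k m = a • (v k 0 * v k (n + m))
      + b • (v k 1 * v k (n + m - 1)) + c • v k (n + m - 1) := by
  rcases h with h | ⟨rfl, rfl⟩
  · exact ⟨_, _, _, fun h' => absurd h' (by omega), v_mul_v_of_two_le k n m h⟩
  · exact ⟨1, 0, 1, fun _ => rfl, by simp [v_commutator k 1 0 one_pos]⟩

/-! ### The operators on delta functions -/

/-- The operator `(-x)ⁿ∂ - (1 + X) n (-x)ⁿ⁻¹` by which `v(n)` acts on the tensor densities supported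
at the origin, over the polynomial ring in the parameter `X` of the conformal weight. In the basis
`g_t = ∂ᵗδ / t!`, `t ≥ 0`, it is `g_t ↦ (t + 1 - n - nX) g_{t+1-n}`, where `g_t = 0` for `t < 0`. -/
noncomputable def densOp (n : ℕ) : Module.End k[X] (ℕ →₀ k[X]) :=
  Finsupp.linearCombination k[X] fun t =>
    if n ≤ t + 1 then Finsupp.single (t + 1 - n) ((t : k[X]) + 1 - n - n * (X : k[X])) else 0

theorem densOp_single (n t : ℕ) (p : k[X]) : densOp k n (Finsupp.single t p) =
    if n ≤ t + 1 then Finsupp.single (t + 1 - n) (p * ((t : k[X]) + 1 - n - n * (X : k[X])))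
    else 0 := by
  rw [densOp, Finsupp.linearCombination_single]
  split_ifs
  · rw [Finsupp.smul_single, smul_eq_mul]
  · rw [smul_zero]

theorem densOp_densOp (n m t : ℕ) :
    densOp k n (densOp k m (Finsupp.single t 1)) = if n + m ≤ t + 2 then
      Finsupp.single (t + 2 - (n + m))
        (((t : k[X]) + 1 - m - m * (X : k[X])) * ((t : k[X]) + 2 - m - n - n * (X : k[X])))
      else 0 := by
  rw [densOp_single]
  by_cases hm : m ≤ t + 1
  · have e : ((t + 1 - m : ℕ) : k[X]) = (t : k[X]) + 1 - m := by
      rw [Nat.cast_sub hm, Nat.cast_add, Nat.cast_one]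
    rw [if_pos hm, densOp_single, e]
    by_cases hnm : n + m ≤ t + 2
    · rw [if_pos hnm, if_pos (by omega), show t + 1 - m + 1 - n = t + 2 - (n + m) by omega]
      congr 1
      ring
    · rw [if_neg hnm, if_neg (by omega)]
  · rw [if_neg hm, map_zero]
    split_ifs with h
    · -- here `n = 0` and `m = t + 2`, and the second factor vanishes
      obtain rfl : n = 0 := by omega
      obtain rfl : m = t + 2 := by omega
      rw [eq_comm, Finsupp.single_eq_zero]
      push_cast
      ring
    · rfl

/-- The action of `Λ` on the tensor densities supported at the origin. -/
noncomputable def densRep : Lam k →ₐ[k] Module.End k[X] (ℕ →₀ k[X]) :=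
  RingQuot.liftAlgHom k (s := Rel k) ⟨FreeAlgebra.lift k (densOp k), by
    intro x y h
    induction h with
    | locality n m hn =>
      refine Finsupp.lhom_ext' fun t => LinearMap.ext_ring ?_
      simp only [map_sub, map_add, map_mul, map_ofNat, map_zero, FreeAlgebra.lift_ι_apply,
        LinearMap.comp_apply, Finsupp.lsingle_apply, LinearMap.zero_apply, LinearMap.sub_apply,
        LinearMap.add_apply, Module.End.mul_apply, Module.End.ofNat_apply]
      obtain ⟨n, rfl⟩ : ∃ l, n = l + 3 := ⟨n - 3, by omega⟩
      simp only [densOp_densOp, show n + 3 - 1 = n + 2 from rfl, show n + 3 - 2 = n + 1 from rfl,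
        show n + 3 - 3 = n from rfl, show n + 2 + (m + 1) = n + 3 + m by omega,
        show n + 1 + (m + 2) = n + 3 + m by omega, show n + (m + 3) = n + 3 + m by omega]
      split_ifs
      · simp only [← Finsupp.single_sub, ← Finsupp.single_add, Finsupp.smul_single,
          nsmul_eq_mul, Finsupp.single_eq_zero]
        push_cast
        ring
      · simp
    | commutator n m hnm =>
      refine Finsupp.lhom_ext' fun t => LinearMap.ext_ring ?_
      simp only [map_sub, map_mul, map_smul, FreeAlgebra.lift_ι_apply,
        LinearMap.comp_apply, Finsupp.lsingle_apply, LinearMap.sub_apply,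
        LinearMap.smul_apply, Module.End.mul_apply]
      rw [densOp_densOp, densOp_densOp, densOp_single, add_comm m n, one_mul]
      by_cases h : n + m ≤ t + 2
      · rw [if_pos h, if_pos h, if_pos (by omega),
          show t + 1 - (n + m - 1) = t + 2 - (n + m) by omega, ← Finsupp.single_sub,
          Finsupp.smul_single, Nat.cast_sub (by omega)]
        congr 1
        rw [Polynomial.smul_eq_C_mul]
        push_cast
        simp only [map_sub, map_natCast]
        ring
      · rw [if_neg h, if_neg h, if_neg (by omega)]
        simp⟩

theorem densRep_v (n : ℕ) : densRep k (v k n) = densOp k n := by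
  simp [densRep, v]

end

section

open Polynomial

variable (k : Type*) [Field k]

/-! ### Linear independence of the reduced words -/

/-- The reduced word `v(0)^A v(1)^B` if `N < 2`, and `v(0)^A v(1)^B v(N)` if `N ≥ 2`. -/
def shape (N A B : ℕ) : List ℕ :=
  List.replicate A 0 ++ (List.replicate B 1 ++ if 2 ≤ N then [N] else [])

theorem exists_shape : ∀ w : List ℕ, w.IsChain (fun n m => ¬ Obstruction n m) →
    ∃ N A B, 1 ≤ N ∧ w = shape N A B
  | [], _ => ⟨1, 0, 0, le_rfl, rfl⟩
  | x :: w, h => by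
    obtain ⟨N, A, B, hN, rfl⟩ := exists_shape w h.tail
    have hx := h.rel_head?
    match x, hx with
    | 0, _ => exact ⟨N, A + 1, B, hN, by simp [shape, List.replicate_succ]⟩
    | 1, hx =>
      obtain rfl : A = 0 := by
        cases A with
        | zero => rfl
        | succ A =>
          exact absurd (Or.inr ⟨rfl, rfl⟩) (hx (y := 0) (by simp [shape, List.replicate_succ]))
      exact ⟨N, 0, B + 1, hN, by simp [shape, List.replicate_succ]⟩
    | x + 2, hx =>
      have h0 : shape N A B = [] := by
        cases h1 : shape N A B with
        | nil => rfl
        | cons y l => exact absurd (Or.inl (by omega)) (hx (y := y) (by simp [h1]))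
      exact ⟨x + 2, 0, 0, by omega, by rw [h0]; simp [shape]⟩

theorem densOp_zero_pow (A : ℕ) (p : k[X]) :
    (densOp k 0 ^ A) (Finsupp.single 0 p) = Finsupp.single A (A.factorial • p) := by
  induction A with
  | zero => simp
  | succ A ih =>
    rw [pow_succ', Module.End.mul_apply, ih, densOp_single, if_pos (by omega),
      Nat.factorial_succ]
    congr 1
    simp only [nsmul_eq_mul]
    push_cast
    ring

theorem densOp_one_pow (B : ℕ) (p : k[X]) :
    (densOp k 1 ^ B) (Finsupp.single 0 p) = Finsupp.single 0 (p * (-X) ^ B) := by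
  induction B with
  | zero => simp
  | succ B ih =>
    rw [pow_succ', Module.End.mul_apply, ih, densOp_single, if_pos (by omega)]
    congr 1
    push_cast
    ring

theorem densRep_word (w : List ℕ) :
    densRep k (w.map (v k)).prod = (w.map (densOp k)).prod := by
  rw [map_list_prod, List.map_map]
  congr 1
  exact List.map_congr_left fun n _ => densRep_v k n

theorem densRep_shape (N A B : ℕ) : densRep k ((shape N A B).map (v k)).prod =
    densOp k 0 ^ A * (densOp k 1 ^ B * if 2 ≤ N then densOp k N else 1) := by
  rw [densRep_word]
  split_ifs with h <;> simp [shape, h]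

/-- The value of the word `v(0)^A v(1)^B v(N)` on `g_{N-1}` is a nonzero multiple of
`X^{B+1} g_A`, and that of `v(0)^A v(1)^B` on `g_0` is a nonzero multiple of `X^B g_A`. -/
theorem densRep_shape_same [CharZero k] (N A B : ℕ) (hN : 1 ≤ N) : ∃ u : k, u ≠ 0 ∧
    densRep k ((shape N A B).map (v k)).prod (Finsupp.single (N - 1) 1) =
      Finsupp.single A (C u * X ^ (if 2 ≤ N then B + 1 else B)) := by
  have hA : (A.factorial : k) ≠ 0 := Nat.cast_ne_zero.2 A.factorial_ne_zero
  rw [densRep_shape]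
  split_ifs with h
  · refine ⟨(A.factorial : k) * (-1) ^ (B + 1) * N,
      mul_ne_zero (mul_ne_zero hA (by simp)) (Nat.cast_ne_zero.2 (by omega)), ?_⟩
    rw [Module.End.mul_apply, Module.End.mul_apply, densOp_single, if_pos (by omega),
      show N - 1 + 1 - N = 0 by omega, densOp_one_pow, densOp_zero_pow, Nat.cast_sub (by omega)]
    congr 1
    simp only [nsmul_eq_mul, map_mul, map_pow, map_neg, map_one, map_natCast, neg_pow (X : k[X])]
    push_cast
    ring
  · obtain rfl : N = 1 := by omega
    refine ⟨(A.factorial : k) * (-1) ^ B, mul_ne_zero hA (by simp), ?_⟩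
    rw [Module.End.mul_apply, Module.End.mul_apply, Module.End.one_apply,
      densOp_one_pow, densOp_zero_pow]
    congr 1
    simp only [nsmul_eq_mul, map_mul, map_pow, map_neg, map_one, map_natCast, neg_pow (X : k[X])]
    ring

theorem densRep_shape_lt (M N A B : ℕ) (hM : 1 ≤ M) (h : M < N) :
    densRep k ((shape N A B).map (v k)).prod (Finsupp.single (M - 1) 1) = 0 := by
  rw [densRep_shape, if_pos (by omega), Module.End.mul_apply, Module.End.mul_apply, densOp_single,
    if_neg (by omega), map_zero, map_zero]

/-- Reduced words are linearly independent in `Λ`. In a linear relation consider the words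
`v(0)^A v(1)^B v(N)` with `N` minimal: only they act nontrivially on `g_{N-1}`, and they can be
told apart by the results. -/
theorem linearCombination_eval_injective [CharZero k] :
    Function.Injective (Finsupp.linearCombination k (RWord.eval k)) := by
  rw [← LinearMap.ker_eq_bot, LinearMap.ker_eq_bot']
  intro f hf
  by_contra hne
  choose N A B hN hw using fun w : RWord => exists_shape w.1 w.2.2
  choose u hu hu' using fun w : RWord => densRep_shape_same k (N w) (A w) (B w) (hN w)
  have hinj (w w' : RWord) (h1 : N w = N w') (h2 : A w = A w') (h3 : B w = B w') : w = w' := by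
    apply Subtype.ext
    rw [hw w, hw w', h1, h2, h3]
  obtain ⟨w₀, hw₀, hmin⟩ := Finset.exists_min_image f.support N (Finsupp.support_nonempty_iff.2 hne)
  have h := congrArg (fun x => ((densRep k x (Finsupp.single (N w₀ - 1) 1)) (A w₀)).coeff
    (if 2 ≤ N w₀ then B w₀ + 1 else B w₀)) hf
  simp only [Finsupp.linearCombination_apply, Finsupp.sum, map_sum, map_smul, LinearMap.sum_apply,
    LinearMap.smul_apply, Finsupp.finsetSum_apply, Finsupp.smul_apply, finsetSum_coeff,
    coeff_smul, map_zero, LinearMap.zero_apply, Finsupp.zero_apply, coeff_zero, RWord.eval] at h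
  rw [Finset.sum_eq_single w₀] at h
  · rw [hw w₀, hu', Finsupp.single_eq_same, coeff_C_mul, coeff_X_pow, if_pos rfl, mul_one] at h
    exact (mul_ne_zero (Finsupp.mem_support_iff.1 hw₀) (hu w₀)) h
  · intro w hwf hww
    rcases (hmin w hwf).lt_or_eq with hlt | heq
    · rw [hw w, densRep_shape_lt k _ _ _ _ (hN w₀) hlt]
      simp
    · rw [hw w, heq, hu', Finsupp.single_apply]
      split_ifs with hA
      all_goals
        try simp only [coeff_C_mul, coeff_X_pow, coeff_zero, smul_zero]
      all_goals
        have hB : B w₀ ≠ B w := fun hB => hww (hinj _ _ heq.symm hA hB.symm)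
        rw [if_neg (by omega)]
        simp
  · exact fun h' => absurd hw₀ h'

/-! ### Normal forms -/

/-- The weight of a word, where `v(i)` has weight `i - 1`. The relations of `Λ` preserve it. -/
def wt (w : List ℕ) : ℤ := (w.map fun i : ℕ => (i : ℤ) - 1).sum

@[simp] theorem wt_nil : wt [] = 0 := rfl

@[simp] theorem wt_cons (i : ℕ) (w : List ℕ) : wt (i :: w) = i - 1 + wt w := by simp [wt]

@[simp] theorem wt_append (w w' : List ℕ) : wt (w ++ w') = wt w + wt w' := by simp [wt]

/-- The last letter of a word, if there is one, is at least `j`. -/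
def LastGE (j : ℕ) (w : List ℕ) : Prop := ∀ i ∈ w.getLast?, j ≤ i

theorem lastGE_concat {j i : ℕ} {w : List ℕ} : LastGE j (w ++ [i]) ↔ j ≤ i := by simp [LastGE]

theorem lastGE_append {j : ℕ} {w w' : List ℕ} (h : w' ≠ []) :
    LastGE j (w ++ w') ↔ LastGE j w' := by
  rw [LastGE, LastGE, List.getLast?_append_of_ne_nil _ h]

theorem LastGE.mono {i j : ℕ} (h : i ≤ j) {w : List ℕ} (hw : LastGE j w) : LastGE i w :=
  fun x hx => h.trans (hw x hx)

/-- `Descends w' w` says that the word `w'` may occur in the course of the reduction of the word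
`w`: it is not larger in the deg-lex order, has the same weight, and its last letter is not
smaller than that of `w`. -/
structure Descends (w' w : List ℕ) : Prop where
  eq_or_lt : w' = w ∨ List.Shortlex (· < ·) w' w
  ne_nil : w ≠ [] → w' ≠ []
  wt_eq : wt w' = wt w
  lastGE : ∀ j, LastGE j w → LastGE j w'

theorem Descends.refl (w : List ℕ) : Descends w w := ⟨.inl rfl, id, rfl, fun _ h => h⟩

theorem Shortlex.trans {a b c : List ℕ} (h : List.Shortlex (· < ·) a b)
    (h' : List.Shortlex (· < ·) b c) : List.Shortlex (· < ·) a c := by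
  rw [List.shortlex_def] at *
  rcases h with h | ⟨h1, h2⟩ <;> rcases h' with h' | ⟨h1', h2'⟩
  · exact .inl (h.trans h')
  · exact .inl (h1' ▸ h)
  · exact .inl (h1 ▸ h')
  · exact .inr ⟨h1.trans h1', List.lt_trans (α := ℕ) h2 h2'⟩

theorem Descends.trans {a b c : List ℕ} (h : Descends a b) (h' : Descends b c) : Descends a c where
  eq_or_lt := by
    rcases h.eq_or_lt with rfl | h1
    · exact h'.eq_or_lt
    rcases h'.eq_or_lt with rfl | h2
    · exact .inr h1
    exact .inr (Shortlex.trans h1 h2)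
  ne_nil := fun hc => h.ne_nil (h'.ne_nil hc)
  wt_eq := h.wt_eq.trans h'.wt_eq
  lastGE := fun j hj => h.lastGE j (h'.lastGE j hj)

theorem Shortlex.append_append {a b : List ℕ} (h : List.Shortlex (· < ·) a b) (p q : List ℕ) :
    List.Shortlex (· < ·) (p ++ (a ++ q)) (p ++ (b ++ q)) := by
  refine List.Shortlex.append_left ?_ p
  rw [List.shortlex_def] at *
  rcases h with h | ⟨h1, h2⟩
  · left
    simpa using h
  · right
    refine ⟨by simpa using h1, ?_⟩
    induction h2 with
    | nil => simp at h1
    | rel h => exact .rel h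
    | cons _ ih => exact .cons (ih (by simpa using h1))

theorem Descends.append_append {a b : List ℕ} (h : Descends a b) (hb : b ≠ []) (p q : List ℕ) :
    Descends (p ++ (a ++ q)) (p ++ (b ++ q)) where
  eq_or_lt := by
    rcases h.eq_or_lt with rfl | h1
    · exact .inl rfl
    · exact .inr (Shortlex.append_append h1 p q)
  ne_nil := by simp [h.ne_nil hb]
  wt_eq := by simp [h.wt_eq]
  lastGE := fun j => by
    rw [lastGE_append (w' := b ++ q) (by simp [hb]),
      lastGE_append (w' := a ++ q) (by simp [h.ne_nil hb])]
    rcases eq_or_ne q [] with rfl | hq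
    · simpa using h.lastGE j
    · rw [lastGE_append hq, lastGE_append hq]
      exact id

theorem descends_rewriting {n m : ℕ} (h : Obstruction n m) :
    (Descends [0, n + m] [n, m] ∧ [0, n + m] ≠ [n, m]) ∧
    (2 ≤ n → Descends [1, n + m - 1] [n, m] ∧ [1, n + m - 1] ≠ [n, m]) ∧
    (Descends [n + m - 1] [n, m] ∧ [n + m - 1] ≠ [n, m]) := by
  have hn : 1 ≤ n := by rcases h with h | h <;> omega
  refine ⟨⟨⟨.inr ?_, by simp, ?_, ?_⟩, ?_⟩, fun hn' => ⟨⟨.inr ?_, by simp, ?_, ?_⟩, ?_⟩,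
    ⟨.inr ?_, by simp, ?_, ?_⟩, ?_⟩
  · exact .of_lex rfl (.rel (by omega))
  · simp
    ring
  · simp [LastGE]
    omega
  · simp
    omega
  · exact .of_lex rfl (.rel (by omega))
  · simp
    omega
  · simp [LastGE]
    omega
  · simp
    omega
  · exact .of_length_lt (by simp)
  · simp
    omega
  · rcases h with h | ⟨rfl, rfl⟩
    · simp [LastGE]
      omega
    · simp [LastGE]
  · simp

/-- The element of `Λ` represented by a word. -/
noncomputable def word (w : List ℕ) : Lam k := (w.map (v k)).prod

theorem word_append (w w' : List ℕ) : word k (w ++ w') = word k w * word k w' := by simp [word]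

/-- The value of a word is a combination of reduced words to which it descends. -/
theorem word_mem_span [CharZero k] (w : List ℕ) (hw : w ≠ []) :
    word k w ∈ Submodule.span k (RWord.eval k '' {r | Descends r.1 w}) := by
  induction w using (List.Shortlex.wf (r := (· < · : ℕ → ℕ → Prop)) wellFounded_lt).induction with
  | _ w ih =>
  by_cases hc : w.IsChain (fun n m => ¬ Obstruction n m)
  · exact Submodule.subset_span ⟨⟨w, hw, hc⟩, Descends.refl w, rfl⟩
  rw [List.isChain_iff_forall_rel_of_append_cons_cons] at hc
  push Not at hc
  obtain ⟨n, m, p, q, rfl, h⟩ := hc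
  have key (s : List ℕ) (hs : Descends s [n, m] ∧ s ≠ [n, m]) : word k p * word k s * word k q ∈
      Submodule.span k (RWord.eval k '' {r | Descends r.1 (p ++ n :: m :: q)}) := by
    have hd : Descends (p ++ (s ++ q)) (p ++ n :: m :: q) := hs.1.append_append (by simp) p q
    have hlt : List.Shortlex (· < ·) (p ++ (s ++ q)) (p ++ n :: m :: q) :=
      Shortlex.append_append (b := [n, m]) (hs.1.eq_or_lt.resolve_left hs.2) p q
    rw [← word_append, ← word_append, List.append_assoc]
    exact Submodule.span_mono (Set.image_mono fun r hr => hr.trans hd)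
      (ih _ hlt (hd.ne_nil hw))
  obtain ⟨a, b, c, hb, habc⟩ := exists_rewriting k h
  obtain ⟨h1, h2, h3⟩ := descends_rewriting h
  have hword : word k (p ++ n :: m :: q) = a • (word k p * word k [0, n + m] * word k q)
      + b • (word k p * word k [1, n + m - 1] * word k q)
      + c • (word k p * word k [n + m - 1] * word k q) := by
    rw [show n :: m :: q = [n, m] ++ q from rfl, word_append, word_append]
    simp only [word, List.map_cons, List.map_nil, List.prod_cons, List.prod_nil, mul_one] at habc ⊢
    rw [habc]
    simp only [add_mul, mul_add, smul_mul_assoc, mul_smul_comm, mul_assoc]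
  rw [hword]
  refine add_mem (add_mem (Submodule.smul_mem _ _ (key _ h1)) ?_)
    (Submodule.smul_mem _ _ (key _ h3))
  by_cases hn : 2 ≤ n
  · exact Submodule.smul_mem _ _ (key _ (h2 hn))
  · rw [hb (by omega), zero_smul]
    exact zero_mem _

theorem eval_mul_eval (a b : RWord) : a.eval k * b.eval k = word k (a.1 ++ b.1) :=
  (word_append k _ _).symm

variable [CharZero k]

theorem normalForm_linearCombination (f : RWord →₀ k) :
    normalForm k (Finsupp.linearCombination k (RWord.eval k) f) = f :=
  Function.leftInverse_invFun (linearCombination_eval_injective k) f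

theorem normalForm_eval (w : RWord) : normalForm k (w.eval k) = Finsupp.single w 1 := by
  simpa using normalForm_linearCombination k (Finsupp.single w 1)

theorem mem_of_mem_support_normalForm {x : Lam k} {s : Set RWord}
    (hx : x ∈ Submodule.span k (RWord.eval k '' s)) {r : RWord}
    (hr : r ∈ (normalForm k x).support) : r ∈ s := by
  obtain ⟨f, hf, rfl⟩ := (Finsupp.mem_span_image_iff_linearCombination k).1 hx
  rw [normalForm_linearCombination] at hr
  exact hf hr

/-- The product of `𝒜₊(U(3))` in the basis of reduced words. -/
noncomputable def mulNF (a b : RWord) : RWord →₀ k := normalForm k (a.eval k * b.eval k)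

theorem descends_of_mem_support_mulNF {a b r : RWord} (hr : r ∈ (mulNF k a b).support) :
    Descends r.1 (a.1 ++ b.1) := by
  rw [mulNF, eval_mul_eval] at hr
  exact mem_of_mem_support_normalForm k (word_mem_span k _ (by simp [a.2.1])) hr

/-- If a word ends in a letter `v(i)` with `i ≥ 2`, then multiplication by `v(m)` from the right
only yields words whose last letter is larger than `m`: the rewriting rule of `v(i)v(m)` ends in
`v(i+m)` or `v(i+m-1)`. -/
theorem lastGE_of_mem_support_mulNF {a r : RWord} {m : ℕ} (ha : LastGE 2 a.1)
    (hr : r ∈ (mulNF k a (letter m)).support) : LastGE (m + 1) r.1 := by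
  obtain ⟨p, i, hp⟩ : ∃ p i, a.1 = p ++ [i] := by
    rcases List.eq_nil_or_concat a.1 with h | ⟨p, i, h⟩
    · exact absurd h a.2.1
    · exact ⟨p, i, by simpa using h⟩
  rw [hp, lastGE_concat] at ha
  rw [mulNF, eval_mul_eval, hp] at hr
  refine mem_of_mem_support_normalForm k (s := {r | LastGE (m + 1) r.1}) ?_ hr
  have key (s : List ℕ) (hs : s ≠ []) (hs' : LastGE (m + 1) s) : word k p * word k s ∈
      Submodule.span k (RWord.eval k '' {r | LastGE (m + 1) r.1}) := by
    rw [← word_append]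
    refine Submodule.span_mono (Set.image_mono fun r hr => ?_) (word_mem_span k _ (by simp [hs]))
    exact hr.lastGE _ ((lastGE_append hs).2 hs')
  have hword : word k (p ++ [i] ++ (letter m).1) = word k p * (v k i * v k m) := by
    rw [List.append_assoc, word_append]
    simp [word, letter]
  have h1 := key [0, i + m] (by simp) (by simp [LastGE]; omega)
  have h2 := key [1, i + m - 1] (by simp) (by simp [LastGE]; omega)
  have h3 := key [i + m - 1] (by simp) (by simp [LastGE]; omega)
  simp only [word, List.map_cons, List.map_nil, List.prod_cons, List.prod_nil, mul_one]
    at h1 h2 h3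
  rw [hword, v_mul_v_of_two_le k i m ha, mul_add, mul_add, mul_smul_comm, mul_smul_comm,
    mul_smul_comm]
  exact add_mem (add_mem (Submodule.smul_mem _ _ h1) (Submodule.smul_mem _ _ h2))
    (Submodule.smul_mem _ _ h3)

theorem linearCombination_mulNF (a b : RWord) :
    Finsupp.linearCombination k (RWord.eval k) (mulNF k a b) = a.eval k * b.eval k := by
  obtain ⟨f, -, hfw⟩ := (Finsupp.mem_span_image_iff_linearCombination k).1
    (word_mem_span k (a.1 ++ b.1) (by simp [a.2.1]))
  rw [mulNF, eval_mul_eval, ← hfw, normalForm_linearCombination]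

theorem mulNF_of_reduced {a b c : RWord} (h : c.1 = a.1 ++ b.1) :
    mulNF k a b = Finsupp.single c 1 := by
  rw [mulNF, eval_mul_eval, ← h]
  exact normalForm_eval k c

theorem mulNF_assoc (a b c : RWord) :
    Finsupp.linearCombination k (fun x => mulNF k x c) (mulNF k a b) =
      Finsupp.linearCombination k (fun x => mulNF k a x) (mulNF k b c) := by
  apply linearCombination_eval_injective k
  have h1 (f : RWord →₀ k) : Finsupp.linearCombination k (RWord.eval k)
      (Finsupp.linearCombination k (fun x => mulNF k x c) f) =
      Finsupp.linearCombination k (RWord.eval k) f * c.eval k := by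
    induction f using Finsupp.induction_linear with
    | zero => simp
    | add f g hf hg => simp [hf, hg, add_mul]
    | single r t => simp [linearCombination_mulNF]
  have h2 (f : RWord →₀ k) : Finsupp.linearCombination k (RWord.eval k)
      (Finsupp.linearCombination k (fun x => mulNF k a x) f) =
      a.eval k * Finsupp.linearCombination k (RWord.eval k) f := by
    induction f using Finsupp.induction_linear with
    | zero => simp
    | add f g hf hg => simp [hf, hg, mul_add]
    | single r t => simp [linearCombination_mulNF]
  rw [h1, h2, linearCombination_mulNF, linearCombination_mulNF, mul_assoc]

end

section

variable (k : Type*) [Field k]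

/-! ### The bar complex -/

/-- The differential of the bar complex. -/
noncomputable def barD : Bar k →ₗ[k] Bar k := Finsupp.linearCombination k (barCellBoundary k)

theorem barD_single (c : List RWord) : barD k (Finsupp.single c 1) = barCellBoundary k c := by
  simp [barD]

/-- `consL a` sends a cell `l` to `[a|l]`. -/
noncomputable def consL (a : RWord) : Bar k →ₗ[k] Bar k := Finsupp.lmapDomain k k (List.cons a)

/-- `headL l` sends a reduced word `w` to `[w|l]`. -/
noncomputable def headL (l : List RWord) : (RWord →₀ k) →ₗ[k] Bar k :=
  Finsupp.lmapDomain k k (fun w => w :: l)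

/-- `pairL f` sends a cell `l` to `[f|l]`. -/
noncomputable def pairL (f : RWord →₀ k) : Bar k →ₗ[k] Bar k :=
  Finsupp.linearCombination k fun l => headL k l f

@[simp] theorem consL_single (a : RWord) (l : List RWord) (t : k) :
    consL k a (Finsupp.single l t) = Finsupp.single (a :: l) t := by simp [consL]

@[simp] theorem headL_single (a : RWord) (l : List RWord) (t : k) :
    headL k l (Finsupp.single a t) = Finsupp.single (a :: l) t := by simp [headL]

@[simp] theorem pairL_single (f : RWord →₀ k) (l : List RWord) (t : k) :
    pairL k f (Finsupp.single l t) = t • headL k l f := by simp [pairL]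

theorem pairL_single_left (a : RWord) (t : k) (y : Bar k) :
    pairL k (Finsupp.single a t) y = t • consL k a y := by
  induction y using Finsupp.induction_linear with
  | zero => simp
  | add f g hf hg => simp [hf, hg]
  | single l s => simp [mul_comm]

theorem pairL_add (f g : RWord →₀ k) (y : Bar k) :
    pairL k (f + g) y = pairL k f y + pairL k g y := by
  induction y using Finsupp.induction_linear with
  | zero => simp
  | add _ _ hf hg =>
    rw [map_add, hf, hg, map_add, map_add]
    abel
  | single l s => simp

theorem barCellBoundary_cons_cons (a b : RWord) (l : List RWord) :
    barCellBoundary k (a :: b :: l) =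
      - headL k l (mulNF k a b) - consL k a (barCellBoundary k (b :: l)) := rfl

theorem barD_consL_headL (a : RWord) (l : List RWord) (f : RWord →₀ k) :
    barD k (consL k a (headL k l f)) =
      - headL k l (Finsupp.linearCombination k (fun x => mulNF k a x) f)
        - consL k a (barD k (headL k l f)) := by
  induction f using Finsupp.induction_linear with
  | zero => simp
  | add f g hf hg =>
    simp only [map_add, hf, hg]
    abel
  | single r t => simp [barD, barCellBoundary_cons_cons, smul_sub]

theorem barD_consL_consL (a b : RWord) (y : Bar k) :
    barD k (consL k a (consL k b y)) =
      - pairL k (mulNF k a b) y - consL k a (barD k (consL k b y)) := by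
  induction y using Finsupp.induction_linear with
  | zero => simp
  | add f g hf hg =>
    simp only [map_add, hf, hg]
    abel
  | single r t => simp [barD, barCellBoundary_cons_cons, smul_sub]

theorem barD_headL_cons (c : RWord) (l : List RWord) (f : RWord →₀ k) :
    barD k (headL k (c :: l) f) =
      - headL k l (Finsupp.linearCombination k (fun x => mulNF k x c) f)
        - pairL k f (barCellBoundary k (c :: l)) := by
  induction f using Finsupp.induction_linear with
  | zero =>
    have h : pairL k (0 : RWord →₀ k) = 0 := by ext1; ext1; simp
    simp [h]
  | add f g hf hg =>
    simp only [map_add, hf, hg, pairL_add]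
    abel
  | single r t => simp [barD, barCellBoundary_cons_cons, smul_sub, pairL_single_left]

theorem barD_barCellBoundary [CharZero k] : ∀ c : List RWord, barD k (barCellBoundary k c) = 0
  | [] => by simp [barCellBoundary]
  | [_] => by simp [barCellBoundary]
  | [a, b] => by
    have h (f : RWord →₀ k) : barD k (headL k [] f) = 0 := by
      induction f using Finsupp.induction_linear with
      | zero => simp
      | add f g hf hg => simp [hf, hg]
      | single r t => simp [barD, barCellBoundary]
    rw [barCellBoundary_cons_cons, show barCellBoundary k [b] = 0 from rfl]
    simp [h]
  | a :: b :: c :: l => by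
    have ih := barD_barCellBoundary (b :: c :: l)
    rw [barCellBoundary_cons_cons, map_sub, map_neg, barCellBoundary_cons_cons k b c l, map_sub,
      map_neg, map_sub, map_neg, barD_headL_cons, barD_consL_headL, barD_consL_consL, mulNF_assoc]
    rw [barCellBoundary_cons_cons k b c l, map_sub, map_neg, sub_eq_zero] at ih
    rw [← ih, map_neg]
    abel

theorem barD_barD [CharZero k] (x : Bar k) : barD k (barD k x) = 0 := by
  induction x using Finsupp.induction_linear with
  | zero => simp
  | add f g hf hg => simp [hf, hg]
  | single c t =>
    rw [← mul_one t, ← smul_eq_mul, ← Finsupp.smul_single, map_smul, map_smul, barD_single,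
      barD_barCellBoundary, smul_zero]

theorem exists_of_mem_support_barCellBoundary : ∀ {c c' : List RWord},
    c' ∈ (barCellBoundary k c).support →
    ∃ q a b l r, c = q ++ a :: b :: l ∧ c' = q ++ r :: l ∧ r ∈ (mulNF k a b).support
  | [], _, h => by simp [barCellBoundary] at h
  | [_], _, h => by simp [barCellBoundary] at h
  | a :: b :: l, c', h => by
    classical
    rw [barCellBoundary_cons_cons] at h
    rcases Finset.mem_union.1 (Finsupp.support_sub h) with h | h
    · rw [Finsupp.support_neg] at h
      obtain ⟨r, hr, rfl⟩ := Finset.mem_image.1 (Finsupp.mapDomain_support h)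
      exact ⟨[], a, b, l, r, rfl, rfl, hr⟩
    · obtain ⟨c'', hc, rfl⟩ := Finset.mem_image.1 (Finsupp.mapDomain_support h)
      obtain ⟨q, a', b', l', r, h1, rfl, hr⟩ := exists_of_mem_support_barCellBoundary hc
      exact ⟨a :: q, a', b', l', r, by rw [h1]; rfl, rfl, hr⟩

/-- The word obtained by concatenating the entries of a cell. -/
def flat (c : List RWord) : List ℕ := c.flatMap fun w => w.1

@[simp] theorem flat_nil : flat [] = [] := rfl

@[simp] theorem flat_cons (w : RWord) (c : List RWord) : flat (w :: c) = w.1 ++ flat c := by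
  simp [flat]

@[simp] theorem flat_append (c c' : List RWord) : flat (c ++ c') = flat c ++ flat c' := by
  simp [flat]

@[simp] theorem flat_map_letter (p : List ℕ) : flat (p.map letter) = p := by
  induction p with
  | nil => rfl
  | cons x p ih => simp [ih, letter]

theorem descends_flat [CharZero k] {c c' : List RWord} (h : c' ∈ (barCellBoundary k c).support) :
    Descends (flat c') (flat c) := by
  obtain ⟨q, a, b, l, r, rfl, rfl, hr⟩ := exists_of_mem_support_barCellBoundary k h
  have h1 := (descends_of_mem_support_mulNF k hr).append_append (by simp [a.2.1]) (flat q) (flat l)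
  simpa using h1

theorem length_of_mem_support {c c' : List RWord} (h : c' ∈ (barCellBoundary k c).support) :
    c.length = c'.length + 1 := by
  obtain ⟨q, a, b, l, r, rfl, rfl, hr⟩ := exists_of_mem_support_barCellBoundary k h
  simp
  omega

/-! ### The Morse matching -/

theorem one_lt_length {x : ℕ} {w w' : RWord} (h : w.1 = x :: w'.1) : 1 < w.1.length := by
  rw [h, List.length_cons]
  have := List.length_pos_of_ne_nil w'.2.1
  omega

theorem parse_unique : ∀ {p p₂ : List ℕ} {w w₂ : RWord} {l l₂ : List RWord},
    1 < w.1.length → 1 < w₂.1.length → p.map letter ++ w :: l = p₂.map letter ++ w₂ :: l₂ →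
    p = p₂ ∧ w = w₂ ∧ l = l₂
  | [], [], _, _, _, _, _, _, h => by simpa using h
  | [], y :: p₂, w, _, _, _, hw, _, h => by
    have h1 : w = letter y := (List.cons.inj h).1
    simp [h1, letter] at hw
  | y :: p, [], _, w, _, _, _, hw, h => by
    have h1 : letter y = w := (List.cons.inj h).1
    simp [← h1, letter] at hw
  | y :: p, y' :: p', _, _, _, _, hw, hw', h => by
    obtain ⟨h1, h2⟩ := List.cons.inj h
    obtain ⟨rfl, h3⟩ := parse_unique hw hw' h2
    exact ⟨by rw [letter_injective h1], h3⟩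

theorem Matched.unique {b c c' : List RWord} (h : Matched b c) (h' : Matched b c') : c = c' := by
  obtain ⟨p, x, w, w', l, -, hw, rfl, rfl⟩ := h
  obtain ⟨p₂, x₂, w₂, w₂', l₂, -, hw₂, hb, rfl⟩ := h'
  obtain ⟨rfl, rfl, rfl⟩ := parse_unique (one_lt_length hw) (one_lt_length hw₂) hb
  obtain ⟨rfl, h2⟩ := List.cons.inj (hw.symm.trans hw₂)
  rw [Subtype.ext h2]

/-- The upper cell `[p|x|w'|l]` of a pair is not a lower cell `[p₂|w₂|l₂]`: the letters `p₂` and the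
first letter of `w₂` form an Anick chain, while `x` followed by the first letter of `w'` is not a
leading word. -/
theorem not_parse : ∀ {p p₂ : List ℕ} {x x₂ : ℕ} {w w' w₂ w₂' : RWord} {l l₂ : List RWord},
    w.1 = x :: w'.1 → w₂.1 = x₂ :: w₂'.1 → (p₂ ++ [x₂]).IsChain Obstruction →
    p.map letter ++ letter x :: w' :: l ≠ p₂.map letter ++ w₂ :: l₂
  | [], [], x, _, _, _, w₂, _, _, _, _, hw₂, _, h => by
    have h1 : letter x = w₂ := (List.cons.inj h).1
    have := one_lt_length hw₂
    simp [← h1, letter] at this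
  | [], y :: p₂, x, x₂, w, w', w₂, w₂', l, l₂, hw, hw₂, hch, h => by
    obtain ⟨h1, h2⟩ := List.cons.inj h
    obtain rfl := letter_injective h1
    have hred := w.2.2
    rw [hw] at hred
    cases p₂ with
    | nil =>
      obtain ⟨rfl, -⟩ := List.cons.inj h2
      rw [hw₂] at hred
      simp only [List.nil_append, List.cons_append, List.isChain_cons_cons] at hch hred
      exact hred.1 hch.1
    | cons z p₂ =>
      obtain ⟨rfl, -⟩ := List.cons.inj h2
      simp only [letter, List.cons_append, List.isChain_cons_cons] at hch hred
      exact hred.1 hch.1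
  | y :: p, [], _, _, _, _, w₂, _, _, _, _, hw₂, _, h => by
    have h1 : letter y = w₂ := (List.cons.inj h).1
    have := one_lt_length hw₂
    simp [← h1, letter] at this
  | y :: p, y' :: p', _, _, _, _, _, _, _, _, hw, hw₂, hch, h =>
    not_parse (p := p) hw hw₂ hch.tail (List.cons.inj h).2

theorem Matched.not_matched {b c d : List RWord} (h : Matched b c) : ¬ Matched c d := by
  rintro ⟨p₂, x₂, w₂, w₂', l₂, hch, hw₂, hb, -⟩
  obtain ⟨p, x, w, w', l, -, hw, -, rfl⟩ := h
  exact not_parse hw hw₂ hch hb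

theorem not_matched_cell (a : AnickChain) (c : List RWord) : ¬ Matched a.cell c := by
  rintro ⟨p, x, w, w', l, -, hw, hb, -⟩
  have : w ∈ a.1.map letter := by
    rw [show a.1.map letter = _ from hb]
    simp
  obtain ⟨i, -, rfl⟩ := List.mem_map.1 this
  simpa [letter] using one_lt_length hw

theorem exists_letter_or_cons (w : RWord) :
    (∃ x, w = letter x) ∨ ∃ x, ∃ w' : RWord, w.1 = x :: w'.1 := by
  obtain ⟨_ | ⟨x, _ | ⟨y, t⟩⟩, h, hc⟩ := w
  · exact absurd rfl h
  · exact .inl ⟨x, rfl⟩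
  · exact .inr ⟨x, ⟨y :: t, by simp, hc.tail⟩, rfl⟩

theorem trichotomy_aux : ∀ (l : List RWord) (p : List ℕ), p.IsChain Obstruction →
    (∃ a : AnickChain, a.cell = p.map letter ++ l) ∨ (∃ c, Matched (p.map letter ++ l) c) ∨
      ∃ b, Matched b (p.map letter ++ l)
  | [], p, hp => .inl ⟨⟨p, hp⟩, by simp [AnickChain.cell]⟩
  | w :: l, p, hp => by
    obtain ⟨y, t, hy⟩ := List.exists_cons_of_ne_nil w.2.1
    by_cases hch : (p ++ [y]).IsChain Obstruction
    · rcases exists_letter_or_cons w with ⟨x, rfl⟩ | ⟨x, w', hw⟩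
      · obtain rfl : x = y := by simpa [letter] using (List.cons.inj hy).1
        have h := trichotomy_aux l (p ++ [x]) hch
        simpa using h
      · obtain ⟨rfl, -⟩ := List.cons.inj (hy.symm.trans hw)
        exact .inr (.inl ⟨_, p, y, w, w', l, hch, hw, rfl, rfl⟩)
    · obtain ⟨p, x, rfl⟩ : ∃ p' x, p = p' ++ [x] := by
        rcases List.eq_nil_or_concat p with rfl | ⟨p', x, rfl⟩
        · simp at hch
        · exact ⟨p', x, by simp⟩
      have hxy : ¬ Obstruction x y := by
        intro h
        refine hch (hp.append (List.isChain_singleton y) ?_)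
        simpa using h
      refine .inr (.inr ⟨p.map letter ++ ⟨x :: w.1, by simp, ?_⟩ :: l, p, x, _, w, l, hp, rfl, rfl,
        by simp⟩)
      have := w.2.2
      rw [hy] at this ⊢
      exact List.isChain_cons_cons.2 ⟨hxy, this⟩

/-- Each cell is an Anick chain or is matched with a cell in the next or in the previous
degree. -/
theorem trichotomy (c : List RWord) :
    (∃ a : AnickChain, a.cell = c) ∨ (∃ d, Matched c d) ∨ ∃ b, Matched b c := by
  simpa using trichotomy_aux c [] List.isChain_nil

theorem boundary_apply_ne_zero [CharZero k] {x : ℕ} {w w' : RWord} (hw : w.1 = x :: w'.1)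
    (l : List RWord) : ∀ p : List ℕ,
    barCellBoundary k (p.map letter ++ letter x :: w' :: l) (p.map letter ++ w :: l) ≠ 0
  | [] => by
    have hne : letter x ≠ w := by
      rintro rfl
      simpa [letter] using one_lt_length hw
    rw [List.map_nil, List.nil_append, List.nil_append, barCellBoundary_cons_cons,
      mulNF_of_reduced k (c := w) (by rw [hw]; rfl), headL_single, Finsupp.sub_apply,
      consL, Finsupp.lmapDomain_apply, Finsupp.mapDomain_of_notMem_range]
    · simp
    · rintro ⟨y, hy⟩
      exact hne (List.cons.inj hy).1
  | y :: p => by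
    have ih := boundary_apply_ne_zero hw l p
    obtain ⟨h, tl, htl⟩ : ∃ (h : ℕ) (tl : List RWord),
        p.map letter ++ letter x :: w' :: l = letter h :: tl := by
      cases p with
      | nil => exact ⟨x, _, rfl⟩
      | cons z p => exact ⟨z, _, rfl⟩
    have hne : tl ≠ p.map letter ++ w :: l := by
      rintro rfl
      have := congrArg (fun c => (flat c).length) htl
      simp [letter, hw] at this
    rw [List.map_cons, List.cons_append, List.cons_append, htl, barCellBoundary_cons_cons, ← htl,
      Finsupp.sub_apply, Finsupp.neg_apply, headL, Finsupp.lmapDomain_apply,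
      Finsupp.mapDomain_of_notMem_range, consL, Finsupp.lmapDomain_apply,
      Finsupp.mapDomain_apply (List.cons_injective)]
    · simpa using ih
    · rintro ⟨r, hr⟩
      exact hne (List.cons.inj hr).2

theorem Matched.boundary_ne_zero [CharZero k] {b c : List RWord} (h : Matched b c) :
    barCellBoundary k c b ≠ 0 := by
  obtain ⟨p, x, w, w', l, -, hw, rfl, rfl⟩ := h
  exact boundary_apply_ne_zero k hw l p

/-- A face of the upper cell of a matched pair, other than the lower cell of the pair, either is
the upper cell of a pair itself, or spells a word which is smaller in the deg-lex order. -/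
theorem Matched.face [CharZero k] {b c b' : List RWord} (h : Matched b c) (hne : b' ≠ b)
    (hb' : b' ∈ (barCellBoundary k c).support) :
    (∃ a, Matched a b') ∨ List.Shortlex (· < ·) (flat b') (flat b) := by
  obtain ⟨p, x, w, w', l, hch, hw, rfl, rfl⟩ := h
  obtain ⟨q, a, b, l₁, r, hc, rfl, hr⟩ := exists_of_mem_support_barCellBoundary k hb'
  have hd := descends_of_mem_support_mulNF k hr
  -- a face that replaces two entries by a smaller word is smaller
  have hlt (hlt : List.Shortlex (· < ·) r.1 (a.1 ++ b.1)) :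
      List.Shortlex (· < ·) (flat (q ++ r :: l₁)) (flat (p.map letter ++ w :: l)) := by
    have h1 := Shortlex.append_append hlt (flat q) (flat l₁)
    have h2 := congrArg flat hc
    simp only [flat_append, flat_cons, letter, List.singleton_append, List.append_assoc] at h1 h2 ⊢
    rwa [← h2, ← List.cons_append, ← hw] at h1
  rcases List.append_eq_append_iff.1 hc with ⟨t, rfl, ht⟩ | ⟨t, ht, ht'⟩
  · match t, ht with
    | [], ht =>
      obtain ⟨rfl, rfl, rfl⟩ : letter x = a ∧ w' = b ∧ l = l₁ := by simpa using ht
      rw [mulNF_of_reduced k (c := w) (by rw [hw]; rfl)] at hr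
      rw [Finset.mem_singleton.1 (Finsupp.support_single_subset hr)] at hne
      simp at hne
    | [_], ht =>
      obtain ⟨rfl, rfl, rfl⟩ : letter x = _ ∧ w' = a ∧ l = b :: l₁ := by simpa using ht
      rcases hd.eq_or_lt with heq | h
      · refine .inl ⟨p.map letter ++ ⟨x :: r.1, by simp, ?_⟩ :: l₁, p, x, _, r, l₁, hch, rfl, rfl,
          by simp⟩
        have h1 := w.2.2
        have h2 := r.2.2
        obtain ⟨y, t, hy⟩ := List.exists_cons_of_ne_nil w'.2.1
        rw [heq, hy] at h2
        rw [hw, hy] at h1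
        rw [heq, hy]
        exact List.isChain_cons_cons.2 ⟨(List.isChain_cons_cons.1 h1).1, h2⟩
      · exact .inr (hlt h)
    | _ :: _ :: t, ht =>
      obtain ⟨rfl, rfl, rfl⟩ : letter x = _ ∧ w' = _ ∧ l = t ++ a :: b :: l₁ := by simpa using ht
      exact .inl ⟨_, p, x, w, w', t ++ r :: l₁, hch, hw, rfl, by simp⟩
  · right
    refine hlt (hd.eq_or_lt.resolve_left fun heq => ?_)
    -- here the two entries are neighbours in the chain `p ++ [x]`
    obtain ⟨q', t', rfl, rfl, rfl⟩ := List.map_eq_append_iff.1 ht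
    have hred := r.2.2
    match t', ht' with
    | [], ht' =>
      obtain ⟨rfl, rfl, rfl⟩ : a = letter x ∧ b = w' ∧ l₁ = l := by simpa using ht'
      rw [mulNF_of_reduced k (c := w) (by rw [hw]; rfl)] at hr
      rw [Finset.mem_singleton.1 (Finsupp.support_single_subset hr)] at hne
      simp at hne
    | [y], ht' =>
      obtain ⟨rfl, rfl, -⟩ : a = letter y ∧ b = letter x ∧ _ := by simpa using ht'
      rw [heq] at hred
      rw [List.append_assoc] at hch
      have h1 : [y, x].IsChain Obstruction := hch.right_of_append
      simp only [letter, List.singleton_append, List.isChain_pair] at h1 hred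
      exact hred h1
    | y :: z :: t', ht' =>
      obtain ⟨rfl, rfl, -⟩ : a = letter y ∧ b = letter z ∧ _ := by simpa using ht'
      rw [heq] at hred
      rw [List.append_assoc] at hch
      have h1 := (List.isChain_cons_cons.1 (hch.right_of_append (l₁ := q'))).1
      simp only [letter, List.singleton_append, List.isChain_pair] at hred
      exact hred h1

end

section

variable (k : Type*) [Field k]

/-! ### The Morse differential -/

/-- Two linear maps out of the bar complex which agree on cells are equal. -/
theorem bar_ext {M : Type*} [AddCommMonoid M] [Module k M] {f g : Bar k →ₗ[k] M}
    (h : ∀ c, f (Finsupp.single c 1) = g (Finsupp.single c 1)) (x : Bar k) : f x = g x := by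
  have : f = g := Finsupp.lhom_ext' fun c => LinearMap.ext_ring (h c)
  rw [this]

open Classical in
/-- The projection onto the span of the lower cells of the matched pairs. -/
noncomputable def lower : Bar k →ₗ[k] Bar k :=
  Finsupp.linearCombination k fun b => if ∃ c, Matched b c then Finsupp.single b 1 else 0

open Classical in
/-- The homotopy that sends the lower cell `b` of a matched pair to `-c / [c : b]`, where `c` is
the upper cell, and all other cells to zero. -/
noncomputable def homotopy : Bar k →ₗ[k] Bar k :=
  Finsupp.linearCombination k fun b => if h : ∃ c, Matched b c then
    -((barCellBoundary k h.choose b)⁻¹ • Finsupp.single h.choose 1) else 0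

theorem zigzag_single (c : List RWord) : zigzag k (Finsupp.single c 1) = zigzagCell k c := by
  simp [zigzag]

variable {k} in
theorem lower_of_matched {b c : List RWord} (h : Matched b c) :
    lower k (Finsupp.single b 1) = Finsupp.single b 1 := by
  rw [lower, Finsupp.linearCombination_single, one_smul, if_pos ⟨c, h⟩]

variable {k} in
theorem lower_of_not_matched {b : List RWord} (h : ¬ ∃ c, Matched b c) :
    lower k (Finsupp.single b 1) = 0 := by
  rw [lower, Finsupp.linearCombination_single, one_smul, if_neg h]

variable {k} in
theorem homotopy_of_matched {b c : List RWord} (h : Matched b c) :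
    homotopy k (Finsupp.single b 1) = -((barCellBoundary k c b)⁻¹ • Finsupp.single c 1) := by
  have h' : ∃ c, Matched b c := ⟨c, h⟩
  rw [homotopy, Finsupp.linearCombination_single, one_smul, dif_pos h', h'.choose_spec.unique h]

variable {k} in
theorem homotopy_of_not_matched {b : List RWord} (h : ¬ ∃ c, Matched b c) :
    homotopy k (Finsupp.single b 1) = 0 := by
  rw [homotopy, Finsupp.linearCombination_single, one_smul, dif_neg h]

variable {k} in
theorem zigzag_of_matched {b c : List RWord} (h : Matched b c) :
    zigzag k (Finsupp.single b 1) =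
      -((barCellBoundary k c b)⁻¹ • (barCellBoundary k c).erase b) := by
  have h' : ∃ c, Matched b c := ⟨c, h⟩
  rw [zigzag_single, zigzagCell, dif_pos h', h'.choose_spec.unique h]

variable {k} in
theorem zigzag_of_not_matched {b : List RWord} (h : ¬ ∃ c, Matched b c) :
    zigzag k (Finsupp.single b 1) = 0 := by
  rw [zigzag_single, zigzagCell, dif_neg h]

theorem zigzag_lower (x : Bar k) : zigzag k (lower k x) = zigzag k x := by
  refine bar_ext k (f := zigzag k ∘ₗ lower k) (fun b => ?_) x
  rw [LinearMap.comp_apply]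
  by_cases h : ∃ c, Matched b c
  · rw [lower_of_matched h.choose_spec]
  · rw [lower_of_not_matched h, zigzag_of_not_matched h, map_zero]

theorem lower_lower (x : Bar k) : lower k (lower k x) = lower k x := by
  refine bar_ext k (f := lower k ∘ₗ lower k) (fun b => ?_) x
  rw [LinearMap.comp_apply]
  by_cases h : ∃ c, Matched b c
  · rw [lower_of_matched h.choose_spec, lower_of_matched h.choose_spec]
  · rw [lower_of_not_matched h, map_zero]

/-- The inclusion of the span of the Anick chains into the bar complex. -/
noncomputable def emb : Anick k →ₗ[k] Bar k := Finsupp.lmapDomain k k AnickChain.cell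

theorem proj_emb (u : Anick k) : proj k (emb k u) = u :=
  Finsupp.comapDomain_mapDomain _ AnickChain.cell_injective u

theorem emb_single (a : AnickChain) (t : k) :
    emb k (Finsupp.single a t) = Finsupp.single a.cell t := by simp [emb]

theorem proj_single_cell (a : AnickChain) (t : k) :
    proj k (Finsupp.single a.cell t) = Finsupp.single a t := by
  rw [← emb_single, proj_emb]

variable {k} in
theorem proj_single_of_ne {c : List RWord} (h : ∀ a : AnickChain, a.cell ≠ c) :
    proj k (Finsupp.single c 1) = 0 := by
  ext a
  change (Finsupp.single c (1 : k)) a.cell = 0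
  rw [Finsupp.single_eq_of_ne (h a)]

theorem proj_lower (x : Bar k) : proj k (lower k x) = 0 := by
  refine bar_ext k (f := proj k ∘ₗ lower k) (g := 0) (fun b => ?_) x
  rw [LinearMap.comp_apply, LinearMap.zero_apply]
  by_cases h : ∃ c, Matched b c
  · obtain ⟨c, h⟩ := h
    rw [lower_of_matched h]
    refine proj_single_of_ne fun a ha => not_matched_cell a c ?_
    rwa [ha]
  · rw [lower_of_not_matched h, map_zero]

theorem pow_zigzag_eq_zero_of_le {x : Bar k} {m n : ℕ} (hmn : m ≤ n)
    (h : (zigzag k ^ m) x = 0) : (zigzag k ^ n) x = 0 := by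
  rw [← Nat.sub_add_cancel hmn, pow_add, Module.End.mul_apply, h, map_zero]

theorem exists_pow_zigzag_of_support (x : Bar k)
    (h : ∀ c ∈ x.support, ∃ n, (zigzag k ^ n) (Finsupp.single c 1) = 0) :
    ∃ n, (zigzag k ^ n) x = 0 := by
  choose! n hn using h
  refine ⟨x.support.sup n, ?_⟩
  have hx : (zigzag k ^ x.support.sup n) x =
      ∑ c ∈ x.support, (zigzag k ^ x.support.sup n) (Finsupp.single c (x c)) := by
    have := congrArg (zigzag k ^ x.support.sup n) x.sum_single.symm
    rwa [Finsupp.sum, map_sum] at this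
  rw [hx]
  refine Finset.sum_eq_zero fun c hc => ?_
  rw [← mul_one (x c), ← smul_eq_mul, ← Finsupp.smul_single, map_smul,
    pow_zigzag_eq_zero_of_le k (Finset.le_sup hc) (hn c hc), smul_zero]

theorem one_sub_zigzag_sum {x : Bar k} {n : ℕ} (h : (zigzag k ^ n) x = 0) :
    (1 - zigzag k) (∑ i ∈ Finset.range n, (zigzag k ^ i) x) = x := by
  have h1 := congrArg (fun f => f x) (mul_neg_geom_sum (zigzag k) n)
  simpa [h, LinearMap.sum_apply] using h1

variable [CharZero k]

theorem zigzag_eq (x : Bar k) : zigzag k x = lower k x + barD k (homotopy k x) := by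
  refine bar_ext k (g := lower k + barD k ∘ₗ homotopy k) (fun b => ?_) x
  rw [LinearMap.add_apply, LinearMap.comp_apply]
  by_cases h : ∃ c, Matched b c
  · obtain ⟨c, h⟩ := h
    rw [lower_of_matched h, homotopy_of_matched h, zigzag_of_matched h, map_neg, map_smul,
      barD_single]
    have h1 := Finsupp.single_add_erase b (barCellBoundary k c)
    have h2 : (barCellBoundary k c b)⁻¹ • Finsupp.single b (barCellBoundary k c b) =
        Finsupp.single b 1 := by
      rw [Finsupp.smul_single, smul_eq_mul, inv_mul_cancel₀ (h.boundary_ne_zero k)]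
    have h3 := congrArg (fun x => (barCellBoundary k c b)⁻¹ • x) h1
    simp only [smul_add, h2] at h3
    rw [← h3]
    abel
  · rw [lower_of_not_matched h, homotopy_of_not_matched h, zigzag_of_not_matched h, map_zero,
      add_zero]

/-- There are only finitely many zigzag paths from a given cell: a step of such a path decreases
the word spelled by a cell in the deg-lex order, unless the path comes to an end. -/
theorem exists_pow_zigzag_single (b : List RWord) :
    ∃ n, (zigzag k ^ n) (Finsupp.single b 1) = 0 := by
  induction hw : flat b using (List.Shortlex.wf (r := (· < · : ℕ → ℕ → Prop))
    wellFounded_lt).induction generalizing b with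
  | _ w ih =>
  subst hw
  by_cases h : ∃ c, Matched b c
  · obtain ⟨c, h⟩ := h
    obtain ⟨n, hn⟩ := exists_pow_zigzag_of_support k (zigzag k (Finsupp.single b 1)) (by
      intro b' hb'
      rw [zigzag_of_matched h, Finsupp.support_neg] at hb'
      have hb'' := Finsupp.support_smul hb'
      rw [Finsupp.support_erase, Finset.mem_erase] at hb''
      rcases h.face k hb''.1 hb''.2 with ⟨a, ha⟩ | hlt
      · refine ⟨1, ?_⟩
        rw [pow_one, zigzag_of_not_matched fun ⟨d, hd⟩ => ha.not_matched hd]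
      · exact ih _ hlt b' rfl)
    exact ⟨n + 1, by rw [pow_succ, Module.End.mul_apply, hn]⟩
  · exact ⟨1, by rw [pow_one, zigzag_of_not_matched h]⟩

theorem exists_pow_zigzag (x : Bar k) : ∃ n, (zigzag k ^ n) x = 0 :=
  exists_pow_zigzag_of_support k x fun c _ => exists_pow_zigzag_single k c

theorem one_sub_zigzag_bijective : Function.Bijective (1 - zigzag k : Module.End k (Bar k)) := by
  constructor
  · rw [← LinearMap.ker_eq_bot, LinearMap.ker_eq_bot']
    intro x hx
    have h1 : zigzag k x = x := by
      rw [LinearMap.sub_apply, Module.End.one_apply, sub_eq_zero] at hx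
      exact hx.symm
    obtain ⟨n, hn⟩ := exists_pow_zigzag k x
    rw [← hn, Module.End.pow_apply, Function.iterate_fixed h1]
  · intro x
    obtain ⟨n, hn⟩ := exists_pow_zigzag k x
    exact ⟨_, one_sub_zigzag_sum k hn⟩

/-- The sum of all powers of `zigzag`, that is, the inverse of `1 - zigzag`. -/
noncomputable def zigzagSum : Bar k →ₗ[k] Bar k :=
  (LinearEquiv.ofBijective (1 - zigzag k) (one_sub_zigzag_bijective k)).symm

theorem zigzagSum_sub (x : Bar k) : zigzagSum k (x - zigzag k x) = x :=
  (LinearEquiv.ofBijective (1 - zigzag k) (one_sub_zigzag_bijective k)).symm_apply_apply x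

theorem sub_zigzagSum (x : Bar k) : zigzagSum k x - zigzag k (zigzagSum k x) = x :=
  (LinearEquiv.ofBijective (1 - zigzag k) (one_sub_zigzag_bijective k)).apply_symm_apply x

theorem zigzagSum_eq_sum {x : Bar k} {n : ℕ} (h : (zigzag k ^ n) x = 0) :
    zigzagSum k x = ∑ i ∈ Finset.range n, (zigzag k ^ i) x := by
  have h1 := one_sub_zigzag_sum k h
  conv_lhs => rw [← h1]
  exact zigzagSum_sub k _

theorem zigzagSum_mem {K : Submodule k (Bar k)} (hK : ∀ x ∈ K, zigzag k x ∈ K) {x : Bar k}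
    (hx : x ∈ K) : zigzagSum k x ∈ K := by
  obtain ⟨n, hn⟩ := exists_pow_zigzag k x
  rw [zigzagSum_eq_sum k hn]
  refine sum_mem fun i hi => ?_
  clear hi
  induction i with
  | zero => simpa
  | succ i ih =>
    rw [pow_succ', Module.End.mul_apply]
    exact hK _ ih

theorem anickBoundary_eq (u : Anick k) :
    anickBoundary k u = proj k (zigzagSum k (barD k (emb k u))) := by
  have h : anickBoundary k = proj k ∘ₗ zigzagSum k ∘ₗ barD k ∘ₗ emb k := by
    refine Finsupp.lhom_ext' fun a => LinearMap.ext_ring ?_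
    simp only [LinearMap.comp_apply, Finsupp.lsingle_apply, emb_single, barD_single, anickBoundary,
      Finsupp.linearCombination_single, one_smul]
    obtain ⟨n, hn⟩ := exists_pow_zigzag k (barCellBoundary k a.cell)
    rw [zigzagSum_eq_sum k hn, map_sum]
    refine finsum_eq_sum_of_support_subset _ fun s hs => ?_
    by_contra hsn
    refine hs ?_
    change proj k _ = 0
    rw [pow_zigzag_eq_zero_of_le k _ hn, map_zero]
    simpa using hsn
  rw [h]
  rfl

/-- The zigzag paths starting from `∂ (homotopy x)` cancel. -/
theorem zigzagSum_barD_homotopy (x : Bar k) :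
    zigzagSum k (barD k (homotopy k x)) = - lower k x := by
  have h1 : zigzagSum k (x - lower k x) = x - lower k x := by
    have := zigzagSum_sub k (x - lower k x)
    rwa [map_sub (zigzag k), zigzag_lower, sub_self, sub_zero] at this
  have h2 := zigzagSum_sub k x
  rw [zigzag_eq] at h2
  rw [map_sub] at h1 h2
  rw [map_add] at h2
  rw [sub_eq_iff_eq_add] at h1 h2
  have h3 := h2.symm.trans h1
  have : zigzagSum k (barD k (homotopy k x)) = (x + (zigzagSum k (lower k x) +
    zigzagSum k (barD k (homotopy k x)))) - x - zigzagSum k (lower k x) := by abel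
  rw [this, h3]
  abel

/-- Up to lower cells and Anick chains, each element of the bar complex is a combination of upper
cells, hence in the image of the homotopy. -/
theorem exists_homotopy_eq (x : Bar k) :
    ∃ z, homotopy k z = x - lower k x - emb k (proj k x) := by
  suffices h : ∀ x : Bar k, x - lower k x - emb k (proj k x) ∈ LinearMap.range (homotopy k) from h x
  intro x
  induction x using Finsupp.induction_linear with
  | zero => simp
  | add x y hx hy =>
    have := add_mem hx hy
    rw [map_add, map_add, map_add]
    convert this using 1
    abel
  | single c t =>
    suffices h : Finsupp.single c 1 - lower k (Finsupp.single c 1)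
        - emb k (proj k (Finsupp.single c 1)) ∈ LinearMap.range (homotopy k) by
      rw [← mul_one t, ← smul_eq_mul, ← Finsupp.smul_single, map_smul, map_smul, map_smul,
        ← smul_sub, ← smul_sub]
      exact Submodule.smul_mem _ _ h
    rcases trichotomy c with ⟨a, rfl⟩ | ⟨d, hd⟩ | ⟨b, hb⟩
    · rw [lower_of_not_matched fun ⟨d, hd⟩ => not_matched_cell a d hd, proj_single_cell,
        emb_single]
      simp
    · rw [lower_of_matched hd, proj_single_of_ne fun a ha => not_matched_cell a d (by rwa [ha])]
      simp
    · rw [lower_of_not_matched fun ⟨d, hd⟩ => hb.not_matched hd]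
      by_cases ha : ∃ a : AnickChain, a.cell = c
      · obtain ⟨a, rfl⟩ := ha
        rw [proj_single_cell, emb_single]
        simp
      · rw [proj_single_of_ne fun a h => ha ⟨a, h⟩, map_zero, sub_zero, sub_zero]
        refine ⟨-(barCellBoundary k c b • Finsupp.single b 1), ?_⟩
        rw [map_neg, map_smul, homotopy_of_matched hb, smul_neg, neg_neg, smul_smul,
          mul_inv_cancel₀ (hb.boundary_ne_zero k), one_smul]

theorem anickBoundary_anickBoundary (u : Anick k) : anickBoundary k (anickBoundary k u) = 0 := by
  set s := zigzagSum k (barD k (emb k u)) with hs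
  -- `y` is a cycle without lower cells, and its part in the span of the Anick chains is `δ u`
  set y := s - lower k s with hy
  have hy' : y = barD k (emb k u) + barD k (homotopy k s) := by
    have h1 := sub_zigzagSum k (barD k (emb k u))
    rw [← hs, zigzag_eq] at h1
    rw [hy, ← h1]
    abel
  have hcycle : barD k y = 0 := by rw [hy', map_add, barD_barD, barD_barD, add_zero]
  have hproj : proj k y = anickBoundary k u := by
    rw [hy, map_sub, proj_lower, sub_zero, anickBoundary_eq]
  obtain ⟨z, hz⟩ := exists_homotopy_eq k y
  have hlow : lower k y = 0 := by rw [hy, map_sub, lower_lower, sub_self]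
  rw [hlow, sub_zero, hproj] at hz
  have h2 : emb k (anickBoundary k u) = y - homotopy k z := by
    rw [hz]
    abel
  rw [anickBoundary_eq, h2, map_sub, hcycle, zero_sub, map_neg, zigzagSum_barD_homotopy, neg_neg,
    proj_lower]

end

section

variable (k : Type*) [Field k]

/-! ### The filtration by the last letter -/

/-- The cells of degree `n` whose last letter is at least `j` and whose weight is at most `W`. -/
def filCells (n j : ℕ) (W : ℤ) : Set (List RWord) :=
  {c | c.length = n ∧ LastGE j (flat c) ∧ wt (flat c) ≤ W}

/-- The span of the cells of degree `n` whose last letter is at least `j` and whose weight is at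
most `W`. -/
noncomputable def fil (n j : ℕ) (W : ℤ) : Submodule k (Bar k) :=
  Finsupp.supported k k (filCells n j W)

/-- The span of the Anick chains in `fil k n j W`, as a subspace of the bar complex. -/
noncomputable def critFil (n j : ℕ) (W : ℤ) : Submodule k (Bar k) :=
  Finsupp.supported k k (filCells n j W ∩ Set.range AnickChain.cell)

/-- The projection of the bar complex onto the span of the Anick chains. -/
noncomputable def crit : Bar k →ₗ[k] Bar k := emb k ∘ₗ proj k

variable {k}

theorem map_supported_le {M : Type*} [AddCommGroup M] [Module k M] {s : Set (List RWord)}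
    {T : Bar k →ₗ[k] M} {K : Submodule k M} (h : ∀ c ∈ s, T (Finsupp.single c 1) ∈ K)
    {x : Bar k} (hx : x ∈ Finsupp.supported k k s) : T x ∈ K := by
  rw [Finsupp.supported_eq_span_single] at hx
  have : Submodule.span k ((fun c => Finsupp.single c (1 : k)) '' s) ≤ K.comap T := by
    rw [Submodule.span_le]
    rintro _ ⟨c, hc, rfl⟩
    exact h c hc
  exact this hx

theorem critFil_le_fil (n j : ℕ) (W : ℤ) : critFil k n j W ≤ fil k n j W :=
  Finsupp.supported_mono Set.inter_subset_left

theorem critFil_mono (n : ℕ) {i j : ℕ} (h : i ≤ j) (W : ℤ) : critFil k n j W ≤ critFil k n i W :=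
  Finsupp.supported_mono fun _ hc => ⟨⟨hc.1.1, hc.1.2.1.mono h, hc.1.2.2⟩, hc.2⟩

theorem crit_single_cell (a : AnickChain) :
    crit k (Finsupp.single a.cell 1) = Finsupp.single a.cell 1 := by
  rw [crit, LinearMap.comp_apply, proj_single_cell, emb_single]

theorem crit_single_of_ne {c : List RWord} (h : ∀ a : AnickChain, a.cell ≠ c) :
    crit k (Finsupp.single c 1) = 0 := by
  rw [crit, LinearMap.comp_apply, proj_single_of_ne h, map_zero]

theorem crit_mem {n j : ℕ} {W : ℤ} {x : Bar k} (hx : x ∈ fil k n j W) :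
    crit k x ∈ critFil k n j W := by
  refine map_supported_le (fun c hc => ?_) hx
  by_cases h : ∃ a : AnickChain, a.cell = c
  · obtain ⟨a, rfl⟩ := h
    rw [crit_single_cell]
    exact Finsupp.single_mem_supported k _ ⟨hc, a, rfl⟩
  · rw [crit_single_of_ne fun a ha => h ⟨a, ha⟩]
    exact zero_mem _

theorem crit_of_mem {n j : ℕ} {W : ℤ} {x : Bar k} (hx : x ∈ critFil k n j W) :
    crit k x = x := by
  rw [← sub_eq_zero]
  refine map_supported_le (T := crit k - LinearMap.id) (K := ⊥) ?_ hx
  rintro _ ⟨-, a, rfl⟩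
  rw [LinearMap.sub_apply, crit_single_cell, LinearMap.id_apply, sub_self]
  exact zero_mem _

/-- Appending letters to a cell. -/
noncomputable def appendR (τ : List ℕ) : Bar k →ₗ[k] Bar k :=
  Finsupp.lmapDomain k k fun c => c ++ τ.map letter

@[simp] theorem appendR_single (τ : List ℕ) (c : List RWord) (t : k) :
    appendR τ (Finsupp.single c t) = Finsupp.single (c ++ τ.map letter) t := by simp [appendR]

theorem appendR_apply (τ : List ℕ) (x : Bar k) (c : List RWord) :
    appendR τ x (c ++ τ.map letter) = x c :=
  Finsupp.mapDomain_apply (List.append_left_injective (τ.map letter)) x c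

/-- If `[y|τ]` has no component in cells `[c|τ]`, then `y = 0`. -/
theorem eq_zero_of_appendR_eq {τ : List ℕ} {n : ℕ} {W : ℤ} {y z : Bar k} (hy : y ∈ fil k n 2 W)
    (hz : ∀ c, LastGE 2 (flat c) → z (c ++ τ.map letter) = 0) (h : appendR τ y = z) : y = 0 := by
  ext c
  by_contra hc
  have hc' := hy (Finsupp.mem_support_iff.2 hc)
  rw [← appendR_apply τ, h] at hc
  exact hc (hz c hc'.2.1)

theorem appendR_cell_mem {τ : List ℕ} {n j : ℕ} {W W' : ℤ} (hτ : LastGE j τ) (hne : τ ≠ [])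
    (hW : W' + wt τ = W) {c : List RWord} (hc : c ∈ filCells n 2 W') :
    c ++ τ.map letter ∈ filCells (n + τ.length) j W := by
  obtain ⟨h1, -, h3⟩ := hc
  refine ⟨by simp [h1], ?_, ?_⟩
  · rwa [flat_append, flat_map_letter, lastGE_append hne]
  · rw [flat_append, flat_map_letter, wt_append]
    omega

theorem appendR_mem {τ : List ℕ} {n j : ℕ} {W W' : ℤ} (hτ : LastGE j τ) (hne : τ ≠ [])
    (hW : W' + wt τ = W) {x : Bar k} (hx : x ∈ fil k n 2 W') :
    appendR τ x ∈ fil k (n + τ.length) j W := by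
  refine map_supported_le (fun c hc => ?_) hx
  rw [appendR_single]
  exact Finsupp.single_mem_supported k _ (appendR_cell_mem hτ hne hW hc)

/-- For a cell `c` without letters `0`, `1` at its end, `c` is an Anick chain if and only if `[c|τ]`
is one, where `τ` is an Anick chain. -/
theorem exists_cell_append_iff {τ : List ℕ} (hτ : τ.IsChain Obstruction) {c : List RWord}
    (hc : LastGE 2 (flat c)) :
    (∃ a : AnickChain, a.cell = c ++ τ.map letter) ↔ ∃ a : AnickChain, a.cell = c := by
  constructor
  · rintro ⟨⟨a, ha⟩, h⟩
    obtain ⟨p, q, rfl, rfl, -⟩ := List.map_eq_append_iff.1 h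
    exact ⟨⟨p, ha.left_of_append⟩, rfl⟩
  · rintro ⟨⟨a, ha⟩, rfl⟩
    rw [AnickChain.cell, flat_map_letter] at hc
    exact ⟨⟨a ++ τ, ha.append hτ fun x hx y _ => .inl (hc x hx)⟩, by simp [AnickChain.cell]⟩

theorem crit_appendR {τ : List ℕ} (hτ : τ.IsChain Obstruction) {n : ℕ} {W : ℤ} {x : Bar k}
    (hx : x ∈ fil k n 2 W) : crit k (appendR τ x) = appendR τ (crit k x) := by
  rw [← sub_eq_zero]
  refine map_supported_le (T := crit k ∘ₗ appendR τ - appendR τ ∘ₗ crit k) (K := ⊥) ?_ hx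
  intro c hc
  rw [Submodule.mem_bot, LinearMap.sub_apply, LinearMap.comp_apply, LinearMap.comp_apply,
    appendR_single, sub_eq_zero]
  have hiff := exists_cell_append_iff hτ hc.2.1
  by_cases h : ∃ a : AnickChain, a.cell = c
  · obtain ⟨a', ha'⟩ := hiff.2 h
    obtain ⟨a, rfl⟩ := h
    rw [← ha', crit_single_cell, crit_single_cell, appendR_single, ha']
  · rw [crit_single_of_ne fun a ha => h ⟨a, ha⟩,
      crit_single_of_ne fun a ha => h (hiff.1 ⟨a, ha⟩), map_zero]

theorem appendR_critFil {τ : List ℕ} (hc : τ.IsChain Obstruction) {n j : ℕ} {W W' : ℤ}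
    (hτ : LastGE j τ) (hne : τ ≠ []) (hW : W' + wt τ = W) {x : Bar k}
    (hx : x ∈ critFil k n 2 W') : appendR τ x ∈ critFil k (n + τ.length) j W := by
  have hx' := critFil_le_fil _ _ _ hx
  rw [← crit_of_mem hx, ← crit_appendR hc hx']
  exact crit_mem (appendR_mem hτ hne hW hx')

theorem Matched.append {b c : List RWord} (h : Matched b c) (l : List RWord) :
    Matched (b ++ l) (c ++ l) := by
  obtain ⟨p, x, w, w', l', h1, h2, rfl, rfl⟩ := h
  exact ⟨p, x, w, w', l' ++ l, h1, h2, by simp, by simp⟩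

theorem Matched.length_eq {b c : List RWord} (h : Matched b c) : c.length = b.length + 1 := by
  obtain ⟨p, x, w, w', l', h1, h2, rfl, rfl⟩ := h
  simp
  omega

theorem Matched.flat_eq {b c : List RWord} (h : Matched b c) : flat c = flat b := by
  obtain ⟨p, x, w, w', l', h1, h2, rfl, rfl⟩ := h
  simp [h2, letter]

theorem Matched.mem_filCells {b c : List RWord} (h : Matched b c) {n j : ℕ} {W : ℤ}
    (hb : b ∈ filCells n j W) : c ∈ filCells (n + 1) j W := by
  obtain ⟨h1, h2, h3⟩ := hb
  exact ⟨by rw [h.length_eq, h1], by rwa [h.flat_eq], by rwa [h.flat_eq]⟩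

/-- The effect on the boundary of appending an entry: the boundary gets one more face. -/
theorem exists_last_face (w z : RWord) : ∀ c : List RWord, ∃ ε : k,
    barCellBoundary k (c ++ [w] ++ [z]) =
      Finsupp.lmapDomain k k (· ++ [z]) (barCellBoundary k (c ++ [w])) +
        ε • Finsupp.lmapDomain k k (fun r => c ++ [r]) (mulNF k w z)
  | [] => ⟨-1, by
      have h : barCellBoundary k [z] = 0 := rfl
      have h' : barCellBoundary k [w] = 0 := rfl
      simp [barCellBoundary_cons_cons, h, h', headL]⟩
  | a :: c => by
    obtain ⟨ε, hε⟩ := exists_last_face w z c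
    obtain ⟨b, l, hbl⟩ : ∃ b l, c ++ [w] = b :: l := List.exists_cons_of_ne_nil (by simp)
    refine ⟨-ε, ?_⟩
    have h1 (f : RWord →₀ k) : Finsupp.lmapDomain k k (· ++ [z]) (headL k l f) =
        headL k (l ++ [z]) f := by
      rw [headL, headL, ← LinearMap.comp_apply, ← Finsupp.lmapDomain_comp]
      rfl
    have h2 (x : Bar k) : Finsupp.lmapDomain k k (· ++ [z]) (consL k a x) =
        consL k a (Finsupp.lmapDomain k k (· ++ [z]) x) := by
      rw [consL, ← LinearMap.comp_apply, ← LinearMap.comp_apply, ← Finsupp.lmapDomain_comp,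
        ← Finsupp.lmapDomain_comp]
      rfl
    have h3 (f : RWord →₀ k) : consL k a (Finsupp.lmapDomain k k (fun r => c ++ [r]) f) =
        Finsupp.lmapDomain k k (fun r => a :: c ++ [r]) f := by
      rw [consL, ← LinearMap.comp_apply, ← Finsupp.lmapDomain_comp]
      rfl
    rw [List.cons_append, List.cons_append, hbl, List.cons_append, barCellBoundary_cons_cons,
      barCellBoundary_cons_cons, ← List.cons_append, ← hbl, hε, map_sub, map_neg, h1, h2, map_add,
      map_smul, h3]
    module

variable [CharZero k]

theorem barD_mem {n j : ℕ} {W : ℤ} {x : Bar k} (hx : x ∈ fil k (n + 1) j W) :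
    barD k x ∈ fil k n j W := by
  refine map_supported_le (fun c hc => ?_) hx
  rw [barD_single]
  intro c' hc'
  have h1 := descends_flat k hc'
  have h2 := length_of_mem_support k hc'
  obtain ⟨h3, h4, h5⟩ := hc
  exact ⟨by omega, h1.lastGE j h4, by rw [h1.wt_eq]; exact h5⟩

theorem zigzag_mem {n j : ℕ} {W : ℤ} {x : Bar k} (hx : x ∈ fil k n j W) :
    zigzag k x ∈ fil k n j W := by
  refine map_supported_le (fun b hb => ?_) hx
  by_cases h : ∃ c, Matched b c
  · obtain ⟨c, h⟩ := h
    have h1 : barCellBoundary k c ∈ fil k n j W := by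
      rw [← barD_single]
      exact barD_mem (Finsupp.single_mem_supported k _ (h.mem_filCells hb))
    rw [zigzag_eq, lower_of_matched h, homotopy_of_matched h, map_neg, map_smul, barD_single]
    exact add_mem (Finsupp.single_mem_supported k _ hb) (neg_mem (Submodule.smul_mem _ _ h1))
  · rw [zigzag_of_not_matched h]
    exact zero_mem _

variable (k) in
/-- The differential of the Anick complex, as an endomorphism of the bar complex. -/
noncomputable def morse : Bar k →ₗ[k] Bar k := crit k ∘ₗ zigzagSum k ∘ₗ barD k

theorem morse_mem {n j : ℕ} {W : ℤ} {x : Bar k} (hx : x ∈ fil k (n + 1) j W) :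
    morse k x ∈ critFil k n j W :=
  crit_mem (zigzagSum_mem k (fun _ => zigzag_mem) (barD_mem hx))

theorem morse_emb (u : Anick k) : morse k (emb k u) = emb k (anickBoundary k u) := by
  rw [anickBoundary_eq]
  rfl

theorem morse_morse {n j : ℕ} {W : ℤ} {x : Bar k} (hx : x ∈ critFil k n j W) :
    morse k (morse k x) = 0 := by
  rw [← crit_of_mem hx, crit, LinearMap.comp_apply, morse_emb, morse_emb,
    anickBoundary_anickBoundary, map_zero]

/-- Appending an Anick chain `τ` commutes with zigzags up to terms in a subspace `K`, provided this
holds for the differential, and `K` does not involve any cell `[c|τ]`. -/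
theorem zigzag_appendR_sub_mem {τ : List ℕ} (hτ : τ.IsChain Obstruction) {n : ℕ} {W : ℤ}
    {K : Submodule k (Bar k)}
    (hv : ∀ x ∈ K, ∀ c, LastGE 2 (flat c) → x (c ++ τ.map letter) = 0)
    (hD : ∀ c ∈ filCells (n + 1) 2 W, barCellBoundary k (c ++ τ.map letter)
      - appendR τ (barCellBoundary k c) ∈ K)
    {y : Bar k} (hy : y ∈ fil k n 2 W) :
    zigzag k (appendR τ y) - appendR τ (zigzag k y) ∈ K := by
  refine map_supported_le (T := zigzag k ∘ₗ appendR τ - appendR τ ∘ₗ zigzag k)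
    (fun b hb => ?_) hy
  rw [LinearMap.sub_apply, LinearMap.comp_apply, LinearMap.comp_apply, appendR_single]
  by_cases h : ∃ c, Matched b c
  · obtain ⟨c, h⟩ := h
    have hd := hD c (h.mem_filCells hb)
    -- the matched edges `[c : b]` and `[c|τ : b|τ]` have the same weight
    have hcoeff : barCellBoundary k (c ++ τ.map letter) (b ++ τ.map letter) =
        barCellBoundary k c b := by
      have := hv _ hd b hb.2.1
      rwa [Finsupp.sub_apply, appendR_apply, sub_eq_zero] at this
    have h' := h.append (τ.map letter)
    rw [zigzag_eq, zigzag_eq, lower_of_matched h', lower_of_matched h, homotopy_of_matched h',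
      homotopy_of_matched h, hcoeff]
    simp only [map_neg, map_smul, map_add, barD_single, appendR_single]
    have : ∀ (p q r : Bar k) (t : k), p + -(t • q) - (p + -(t • r)) = -(t • (q - r)) := by
      intros
      module
    rw [this]
    exact neg_mem (Submodule.smul_mem _ _ hd)
  · have h' : ¬ ∃ c, Matched (b ++ τ.map letter) c := by
      rintro ⟨d, hd⟩
      rcases trichotomy b with ha | hb' | ⟨b', hb'⟩
      · obtain ⟨a, ha⟩ := (exists_cell_append_iff hτ hb.2.1).2 ha
        rw [← ha] at hd
        exact not_matched_cell a d hd
      · exact h hb'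
      · exact (hb'.append _).not_matched hd
    rw [zigzag_of_not_matched h, zigzag_of_not_matched h', map_zero, sub_zero]
    exact zero_mem _

/-- Appending an Anick chain `τ` commutes with the differential of the Anick complex up to terms in
the subspaces `K n`, provided this holds for the differential of the bar complex, and `K n` is
stable under zigzags and does not involve any cell `[c|τ]`. -/
theorem exists_morse_appendR {τ : List ℕ} (hτ : τ.IsChain Obstruction) {W : ℤ}
    (K : ℕ → Submodule k (Bar k)) (hZ : ∀ n, ∀ x ∈ K n, zigzag k x ∈ K n)
    (hv : ∀ n, ∀ x ∈ K n, ∀ c, LastGE 2 (flat c) → x (c ++ τ.map letter) = 0)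
    (hD : ∀ n, ∀ c ∈ filCells (n + 1) 2 W, barCellBoundary k (c ++ τ.map letter)
      - appendR τ (barCellBoundary k c) ∈ K n)
    {n : ℕ} {x : Bar k} (hx : x ∈ fil k (n + 1) 2 W) :
    ∃ y ∈ K n, morse k (appendR τ x) = appendR τ (morse k x) + crit k y := by
  have hD' : barD k (appendR τ x) - appendR τ (barD k x) ∈ K n := by
    refine map_supported_le (T := barD k ∘ₗ appendR τ - appendR τ ∘ₗ barD k) (fun c hc => ?_) hx
    simpa [barD_single] using hD n c hc
  have hZ' (y : Bar k) (hy : y ∈ fil k n 2 W) :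
      zigzag k (appendR τ y) - appendR τ (zigzag k y) ∈ K n :=
    zigzag_appendR_sub_mem hτ (hv n) (hD n) hy
  have hy : barD k x ∈ fil k n 2 W := barD_mem hx
  set y := barD k x
  have hSy := zigzagSum_mem k (fun _ => zigzag_mem) hy
  have hS : appendR τ (zigzagSum k y) - zigzagSum k (appendR τ y) ∈ K n := by
    set d := appendR τ (zigzagSum k y) - zigzagSum k (appendR τ y) with hd
    rw [← zigzagSum_sub k d]
    refine zigzagSum_mem k (hZ n) ?_
    have h1 : d - zigzag k d =
        - (zigzag k (appendR τ (zigzagSum k y)) - appendR τ (zigzag k (zigzagSum k y))) := by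
      have h2 := congrArg (appendR τ) (sub_zigzagSum k y)
      have h3 := sub_zigzagSum k (appendR τ y)
      rw [map_sub] at h2
      calc d - zigzag k d
          = (appendR τ (zigzagSum k y) - zigzag k (appendR τ (zigzagSum k y)))
            - (zigzagSum k (appendR τ y) - zigzag k (zigzagSum k (appendR τ y))) := by
            rw [hd, map_sub]
            abel
        _ = _ := by
            rw [h3, ← h2]
            abel
    rw [h1]
    exact neg_mem (hZ' _ hSy)
  refine ⟨zigzagSum k (barD k (appendR τ x) - appendR τ y)
    - (appendR τ (zigzagSum k y) - zigzagSum k (appendR τ y)),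
    sub_mem (zigzagSum_mem k (hZ n) hD') hS, ?_⟩
  simp only [morse, LinearMap.comp_apply]
  rw [← crit_appendR hτ hSy, ← map_add]
  congr 1
  rw [map_sub]
  abel

end

section

variable {k : Type*} [Field k]

/-! ### Decompositions by the last letter -/

theorem two_le_of_isChain {p : List ℕ} (hp : p.IsChain Obstruction) (h : LastGE 2 p) :
    ∀ i ∈ p, 2 ≤ i := by
  induction p with
  | nil => simp
  | cons x p ih =>
    rcases List.eq_nil_or_concat' p with rfl | ⟨q, y, hq⟩
    · simpa [LastGE] using h
    · have hne : p ≠ [] := by simp [hq]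
      rw [← List.singleton_append, lastGE_append hne] at h
      have ih' := ih hp.tail h
      intro i hi
      rcases List.mem_cons.1 hi with rfl | hi
      · obtain ⟨z, l, rfl⟩ := List.exists_cons_of_ne_nil hne
        have h1 := (List.isChain_cons_cons.1 hp).1
        have h2 := ih' z (by simp)
        rcases h1 with h1 | h1 <;> omega
      · exact ih' i hi

theorem wt_nonneg {p : List ℕ} (h : ∀ i ∈ p, 2 ≤ i) : 0 ≤ wt p := by
  refine List.sum_nonneg fun x hx => ?_
  obtain ⟨i, hi, rfl⟩ := List.mem_map.1 hx
  have := h i hi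
  omega

/-- In an Anick chain whose last letter is not `0`, the other letters are at least two. -/
theorem lastGE_two_of_isChain {p : List ℕ} {i : ℕ} (h : (p ++ [i]).IsChain Obstruction)
    (hi : 1 ≤ i) : LastGE 2 p := by
  intro y hy
  have := (List.isChain_append.1 h).2.2 y hy i (by simp)
  rcases this with h | h <;> omega

/-- The letters of an Anick chain other than the last one have nonnegative weight, so that the
weight bounds the last letter. -/
theorem eq_zero_of_mem_critFil {n j : ℕ} {W : ℤ} (hj : 1 ≤ j) (hW : W + 1 < j) {x : Bar k}
    (hx : x ∈ critFil k (n + 1) j W) : x = 0 := by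
  refine map_supported_le (T := LinearMap.id) (K := ⊥) ?_ hx
  rintro _ ⟨⟨h1, h2, h3⟩, ⟨a, ha⟩, rfl⟩
  exfalso
  rw [AnickChain.cell, flat_map_letter] at h2 h3
  rw [AnickChain.cell, List.length_map] at h1
  rcases List.eq_nil_or_concat' a with rfl | ⟨p, i, rfl⟩
  · simp at h1
  · rw [lastGE_concat] at h2
    have h4 := lastGE_two_of_isChain ha (by omega)
    have h5 := wt_nonneg (two_le_of_isChain ha.left_of_append h4)
    simp at h3
    omega

theorem critFil_le_sup {n j : ℕ} (hj : 1 ≤ j) {W W' : ℤ} (hW : W' + j = W + 1) :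
    critFil k (n + 1) j W ≤
      (critFil k n 2 W').map (appendR [j]) ⊔ critFil k (n + 1) (j + 1) W := by
  intro x hx
  refine map_supported_le (T := LinearMap.id) ?_ hx
  rintro _ ⟨⟨h1, h2, h3⟩, ⟨a, ha⟩, rfl⟩
  rw [LinearMap.id_apply]
  rcases List.eq_nil_or_concat' a with rfl | ⟨p, i, rfl⟩
  · simp [AnickChain.cell] at h1
  rcases eq_or_ne i j with rfl | hij
  · refine Submodule.mem_sup_left ⟨Finsupp.single (p.map letter) 1,
      Finsupp.single_mem_supported k _ ⟨⟨?_, ?_, ?_⟩, ⟨p, ha.left_of_append⟩, rfl⟩, ?_⟩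
    · simpa [AnickChain.cell] using h1
    · rw [flat_map_letter]
      exact lastGE_two_of_isChain ha hj
    · rw [AnickChain.cell, flat_map_letter, wt_append] at h3
      rw [flat_map_letter]
      simp at h3
      omega
    · simp [AnickChain.cell]
  · refine Submodule.mem_sup_right (Finsupp.single_mem_supported k _
      ⟨⟨h1, ?_, h3⟩, ⟨p ++ [i], ha⟩, rfl⟩)
    rw [AnickChain.cell, flat_map_letter, lastGE_concat] at h2 ⊢
    omega

theorem critFil_zero_le_sup {n : ℕ} {W : ℤ} : critFil k (n + 2) 0 W ≤
    (critFil k n 2 (W + 1)).map (appendR [1, 0]) ⊔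
      ((critFil k (n + 1) 2 (W + 1)).map (appendR [0]) ⊔ critFil k (n + 2) 1 W) := by
  intro x hx
  refine map_supported_le (T := LinearMap.id) ?_ hx
  rintro _ ⟨⟨h1, -, h3⟩, ⟨a, ha⟩, rfl⟩
  rw [LinearMap.id_apply]
  rcases List.eq_nil_or_concat' a with rfl | ⟨p, i, rfl⟩
  · simp [AnickChain.cell] at h1
  rcases List.eq_nil_or_concat' p with rfl | ⟨p, y, rfl⟩
  · simp [AnickChain.cell] at h1
  rw [AnickChain.cell, flat_map_letter, wt_append, wt_append] at h3
  simp only [wt_cons, wt_nil] at h3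
  have h4 := (List.isChain_append.1 ha).2.2 y (by simp) i (by simp)
  rcases Nat.eq_zero_or_pos i with rfl | hi
  · by_cases hy : 2 ≤ y
    · refine Submodule.mem_sup_right (Submodule.mem_sup_left
        ⟨Finsupp.single ((p ++ [y]).map letter) 1,
        Finsupp.single_mem_supported k _ ⟨⟨?_, ?_, ?_⟩, ⟨p ++ [y], ha.left_of_append⟩, rfl⟩, ?_⟩)
      · simpa [AnickChain.cell] using h1
      · rwa [flat_map_letter, lastGE_concat]
      · rw [flat_map_letter, wt_append]
        simp only [wt_cons, wt_nil]
        omega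
      · simp [AnickChain.cell]
    · obtain rfl : y = 1 := by rcases h4 with h4 | h4 <;> omega
      refine Submodule.mem_sup_left ⟨Finsupp.single (p.map letter) 1,
        Finsupp.single_mem_supported k _
          ⟨⟨?_, ?_, ?_⟩, ⟨p, ha.left_of_append.left_of_append⟩, rfl⟩, ?_⟩
      · simpa [AnickChain.cell] using h1
      · rw [flat_map_letter]
        exact lastGE_two_of_isChain ha.left_of_append le_rfl
      · rw [flat_map_letter]
        omega
      · simp [AnickChain.cell]
  · refine Submodule.mem_sup_right (Submodule.mem_sup_right (Finsupp.single_mem_supported k _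
      ⟨⟨h1, ?_, ?_⟩, ⟨p ++ [y] ++ [i], ha⟩, rfl⟩))
    · rw [AnickChain.cell, flat_map_letter, lastGE_concat]
      exact hi
    · rw [AnickChain.cell, flat_map_letter, wt_append, wt_append]
      simp only [wt_cons, wt_nil]
      omega

/-! ### Appending letters to Anick chains -/

theorem apply_eq_zero_of_fil {n j i : ℕ} {W : ℤ} {x : Bar k} (hx : x ∈ fil k n j W)
    (hij : i < j) (p : List ℕ) (c : List RWord) : x (c ++ (p ++ [i]).map letter) = 0 := by
  by_contra h
  have h1 := (hx (Finsupp.mem_support_iff.2 h)).2.1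
  rw [flat_append, flat_map_letter, ← List.append_assoc, lastGE_concat] at h1
  omega

/-- The span of the cells that end in a letter `≥ 1`, or in an entry with last letter `≥ 2` which is
followed by `[0]`. -/
noncomputable def remainder (k : Type*) [Field k] (n : ℕ) (W : ℤ) : Submodule k (Bar k) :=
  fil k (n + 2) 1 W ⊔ (fil k (n + 1) 2 (W + 1)).map (appendR [0])

/-- The span of the Anick chains that end in a letter `≥ 1`, or in `[i|0]` with `i ≥ 2`. -/
noncomputable def critRemainder (k : Type*) [Field k] (n : ℕ) (W : ℤ) : Submodule k (Bar k) :=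
  critFil k (n + 2) 1 W ⊔ (critFil k (n + 1) 2 (W + 1)).map (appendR [0])

theorem critRemainder_le_remainder (n : ℕ) (W : ℤ) : critRemainder k n W ≤ remainder k n W :=
  sup_le_sup (critFil_le_fil _ _ _) (Submodule.map_mono (critFil_le_fil _ _ _))

theorem crit_mem_critRemainder {n : ℕ} {W : ℤ} {x : Bar k} (hx : x ∈ remainder k n W) :
    crit k x ∈ critRemainder k n W := by
  obtain ⟨y, hy, _, ⟨z, hz, rfl⟩, rfl⟩ := Submodule.mem_sup.1 hx
  rw [map_add, crit_appendR (List.isChain_singleton 0) hz]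
  exact add_mem (Submodule.mem_sup_left (crit_mem hy))
    (Submodule.mem_sup_right (Submodule.mem_map_of_mem (crit_mem hz)))

theorem apply_eq_zero_of_remainder {n : ℕ} {W : ℤ} {x : Bar k} (hx : x ∈ remainder k n W)
    (c : List RWord) : x (c ++ [1, 0].map letter) = 0 := by
  obtain ⟨y, hy, _, ⟨z, hz, rfl⟩, rfl⟩ := Submodule.mem_sup.1 hx
  rw [Finsupp.add_apply, show [1, 0] = [1] ++ [0] from rfl,
    apply_eq_zero_of_fil hy one_pos [1] c, zero_add,
    show c ++ ([1] ++ [0] : List ℕ).map letter =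
      (c ++ ([] ++ [1] : List ℕ).map letter) ++ [0].map letter by simp, appendR_apply]
  exact apply_eq_zero_of_fil hz one_lt_two [] c

variable [CharZero k]

theorem lastFace_mem {n m : ℕ} {W W' : ℤ} (hW : W' + m = W + 1) {c : List RWord}
    (hc : c ∈ filCells (n + 1) 2 W') :
    barCellBoundary k (c ++ [m].map letter) - appendR [m] (barCellBoundary k c) ∈
      fil k (n + 1) (m + 1) W := by
  obtain ⟨h1, h2, h3⟩ := hc
  obtain ⟨c, w, rfl⟩ : ∃ c' w, c = c' ++ [w] := by
    rcases List.eq_nil_or_concat c with rfl | ⟨c', w, rfl⟩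
    · simp at h1
    · exact ⟨c', w, by simp⟩
  obtain ⟨ε, hε⟩ := exists_last_face (k := k) w (letter m) c
  rw [List.map_singleton, hε]
  simp only [appendR, List.map_singleton, add_sub_cancel_left]
  refine Submodule.smul_mem _ _ fun c' hc' => ?_
  classical
  obtain ⟨r, hr, rfl⟩ := Finset.mem_image.1 (Finsupp.mapDomain_support hc')
  have hd := descends_of_mem_support_mulNF k hr
  have hw : flat (c ++ [w]) = flat c ++ w.1 := by simp
  have hr' : flat (c ++ [r]) = flat c ++ r.1 := by simp
  rw [hw] at h2 h3
  rw [lastGE_append w.2.1] at h2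
  refine ⟨by simpa using h1, ?_, ?_⟩
  · rw [hr', lastGE_append r.2.1]
    exact lastGE_of_mem_support_mulNF k h2 hr
  · rw [hr', wt_append, hd.wt_eq, wt_append, ← add_assoc, ← wt_append]
    simp only [letter, wt_cons, wt_nil]
    omega

/-- Up to terms with a larger last letter, the differential of `[a|m]` is `[δa|m]`. -/
theorem exists_morse_append_letter (m : ℕ) {n : ℕ} {W W' : ℤ} (hW : W' + m = W + 1) {x : Bar k}
    (hx : x ∈ fil k (n + 1) 2 W') : ∃ y ∈ critFil k (n + 1) (m + 1) W,
      morse k (appendR [m] x) = appendR [m] (morse k x) + y := by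
  obtain ⟨y, hy, h⟩ := exists_morse_appendR (τ := [m]) (List.isChain_singleton m)
    (fun n => fil k (n + 1) (m + 1) W) (fun _ _ => zigzag_mem)
    (fun _ _ hx c _ => apply_eq_zero_of_fil hx (Nat.lt_succ_self m) [] c)
    (fun _ _ hc => lastFace_mem hW hc) hx
  exact ⟨crit k y, crit_mem hy, h⟩

theorem mulNF_one_zero : mulNF k (letter 1) (letter 0) =
    Finsupp.single ⟨[0, 1], by simp, by simp [Obstruction]⟩ 1 + Finsupp.single (letter 0) 1 := by
  rw [mulNF, ← normalForm_linearCombination k (_ + _)]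
  congr 1
  have := v_commutator k 1 0 one_pos
  simpa [RWord.eval, letter] using this

theorem zigzag_mem_remainder (n : ℕ) (W : ℤ) (x : Bar k) (hx : x ∈ remainder k n W) :
    zigzag k x ∈ remainder k n W := by
  have h : remainder k n W ≤ (remainder k n W).comap (zigzag k) := by
    refine sup_le (fun x hx => Submodule.mem_sup_left (zigzag_mem hx)) ?_
    rintro _ ⟨x, hx, rfl⟩
    have h1 : zigzag k (appendR [0] x) - appendR [0] (zigzag k x) ∈ fil k (n + 2) 1 W := by
      exact zigzag_appendR_sub_mem (τ := [0]) (List.isChain_singleton 0)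
        (fun _ hx c _ => apply_eq_zero_of_fil hx one_pos [] c)
        (fun _ hc => lastFace_mem (by push_cast; ring) hc) hx
    rw [Submodule.mem_comap, ← sub_add_cancel (zigzag k (appendR [0] x)) (appendR [0] (zigzag k x))]
    exact add_mem (Submodule.mem_sup_left h1)
      (Submodule.mem_sup_right (Submodule.mem_map_of_mem (zigzag_mem hx)))
  exact h hx

/-- Up to terms that end in `[i|0]` with `i ≥ 2` or in a letter `≥ 1`, the differential of `[a|1|0]`
is `[δa|1|0]`. -/
theorem exists_morse_append_one_zero {n : ℕ} {W : ℤ} {x : Bar k}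
    (hx : x ∈ fil k (n + 1) 2 (W + 1)) :
    ∃ y ∈ critRemainder k n W,
      morse k (appendR [1, 0] x) = appendR [1, 0] (morse k x) + y := by
  suffices h : ∃ y ∈ remainder k n W,
      morse k (appendR [1, 0] x) = appendR [1, 0] (morse k x) + crit k y by
    obtain ⟨y, hy, h⟩ := h
    exact ⟨crit k y, crit_mem_critRemainder hy, h⟩
  refine exists_morse_appendR (τ := [1, 0]) (by simp [Obstruction]) (fun n => remainder k n W)
    (fun n => zigzag_mem_remainder n W) (fun _ _ hx c _ => apply_eq_zero_of_remainder hx c) ?_ hx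
  · intro n c hc
    have h1 := lastFace_mem (k := k) (m := 1) (W' := W + 1) (W := W + 1) rfl hc
    obtain ⟨ε, hε⟩ := exists_last_face (k := k) (letter 1) (letter 0) c
    have h2 : barCellBoundary k (c ++ [1, 0].map letter) - appendR [1, 0] (barCellBoundary k c) =
        appendR [0] (barCellBoundary k (c ++ [1].map letter) - appendR [1] (barCellBoundary k c)) +
          ε • Finsupp.lmapDomain k k (fun r => c ++ [r]) (mulNF k (letter 1) (letter 0)) := by
      have h3 (y : Bar k) : appendR [0] (appendR [1] y) = appendR [1, 0] y :=
        bar_ext k (f := appendR [0] ∘ₗ appendR [1]) (by simp) y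
      rw [map_sub, h3, show c ++ [1, 0].map letter = c ++ [letter 1] ++ [letter 0] by simp, hε]
      simp only [appendR, List.map_singleton]
      abel
    obtain ⟨h4, h5, h6⟩ := hc
    rw [h2, mulNF_one_zero, map_add, Finsupp.lmapDomain_apply, Finsupp.lmapDomain_apply,
      Finsupp.mapDomain_single, Finsupp.mapDomain_single]
    refine add_mem (Submodule.mem_sup_right (Submodule.mem_map_of_mem h1))
      (Submodule.smul_mem _ _ (add_mem (Submodule.mem_sup_left ?_) (Submodule.mem_sup_right ?_)))
    · refine Finsupp.single_mem_supported k _ ⟨by simp [h4], ?_, ?_⟩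
      · rw [flat_append, lastGE_append (by simp)]
        simp [LastGE]
      · rw [flat_append, wt_append]
        simp
        omega
    · refine ⟨Finsupp.single c 1, Finsupp.single_mem_supported k _ ⟨h4, h5, h6⟩, by simp⟩

/-! ### The differential in low degrees -/

theorem zigzag_singleton (w : RWord) : zigzag k (Finsupp.single [w] 1) = 0 := by
  by_cases h : ∃ c, Matched [w] c
  · obtain ⟨c, p, x, w₁, w', l, hch, hw, hb, rfl⟩ := h
    have hlen := congrArg List.length hb
    simp only [List.length_append, List.length_map, List.length_cons, List.length_nil] at hlen
    obtain rfl : p = [] := List.length_eq_zero_iff.1 (by omega)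
    obtain rfl : l = [] := List.length_eq_zero_iff.1 (by omega)
    obtain rfl : w = w₁ := by simpa using hb
    have hm : Matched [w] [letter x, w'] := ⟨[], x, w, w', [], hch, hw, rfl, rfl⟩
    have h0 : barCellBoundary k [w'] = 0 := rfl
    have hb : barCellBoundary k [letter x, w'] = Finsupp.single [w] (-1) := by
      rw [barCellBoundary_cons_cons, mulNF_of_reduced k (c := w) (by rw [hw]; rfl), headL_single,
        h0, map_zero, sub_zero, Finsupp.single_neg]
    change zigzag k (Finsupp.single [w] 1) = 0
    rw [zigzag_of_matched hm, hb, Finsupp.erase_single, smul_zero, neg_zero]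
  · exact zigzag_of_not_matched h

theorem zigzagSum_headL_nil (f : RWord →₀ k) : zigzagSum k (headL k [] f) = headL k [] f := by
  have h : zigzag k (headL k [] f) = 0 := by
    induction f using Finsupp.induction_linear with
    | zero => simp
    | add f g hf hg => rw [map_add, map_add, hf, hg, add_zero]
    | single w t =>
      rw [headL_single, ← mul_one t, ← smul_eq_mul, ← Finsupp.smul_single, map_smul,
        zigzag_singleton, smul_zero]
  have := zigzagSum_sub k (headL k [] f)
  rwa [h, sub_zero] at this

theorem morse_two_letter (m : ℕ) : ∃ r : k, r ≠ 0 ∧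
    morse k (Finsupp.single [letter 2, letter m] 1) = r • Finsupp.single [letter (m + 1)] 1 := by
  have hm : ((2 : ℕ) : k) + m - 1 ≠ 0 := by
    have : ((m + 1 : ℕ) : k) ≠ 0 := Nat.cast_ne_zero.2 (by omega)
    convert this using 1
    push_cast
    ring
  have h := v_mul_v_of_two_le k 2 m le_rfl
  rw [show 2 + m - 1 = m + 1 by omega] at h
  set a := -(((2 : ℕ) : k) - 1) * (m - 1) / ((2 : ℕ) + m - 1)
  set b := ((2 : ℕ) : k) * m / ((2 : ℕ) + m - 1)
  set r := ((2 : ℕ) : k) * ((2 : ℕ) - 1) / ((2 : ℕ) + m - 1) with hr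
  let w₀ : RWord := ⟨[0, 2 + m], by simp, by simp [Obstruction]⟩
  let w₁ : RWord := ⟨[1, m + 1], by simp, by simp [Obstruction]⟩
  have hmul : mulNF k (letter 2) (letter m) = a • Finsupp.single w₀ 1 + b • Finsupp.single w₁ 1
      + r • Finsupp.single (letter (m + 1)) 1 := by
    rw [mulNF, ← normalForm_linearCombination k (_ + _)]
    congr 1
    simpa [RWord.eval, letter, w₀, w₁] using h
  have hne (w : RWord) (hw : w.1.length = 2) (c : AnickChain) : c.cell ≠ [w] := by
    intro h
    have : w ∈ c.1.map letter := by
      rw [show c.1.map letter = [w] from h]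
      simp
    obtain ⟨i, -, rfl⟩ := List.mem_map.1 this
    simp [letter] at hw
  have h0 : barCellBoundary k [letter m] = 0 := rfl
  refine ⟨-r, ?_, ?_⟩
  · rw [neg_ne_zero, hr]
    refine div_ne_zero ?_ hm
    norm_num
  · rw [morse, LinearMap.comp_apply, LinearMap.comp_apply, barD_single, barCellBoundary_cons_cons,
      h0, map_zero, sub_zero, map_neg, zigzagSum_headL_nil, hmul]
    simp only [map_add, map_smul, map_neg, headL_single]
    rw [crit_single_of_ne (hne w₀ rfl), crit_single_of_ne (hne w₁ rfl),
      show [letter (m + 1)] = AnickChain.cell ⟨[m + 1], by simp⟩ from rfl, crit_single_cell]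
    module

theorem morse_of_mem_one {j : ℕ} {W : ℤ} {x : Bar k} (hx : x ∈ fil k 1 j W) : morse k x = 0 := by
  refine map_supported_le (K := ⊥) (fun c hc => ?_) hx
  obtain ⟨w, rfl⟩ := List.length_eq_one_iff.1 hc.1
  have h0 : barCellBoundary k [w] = 0 := rfl
  rw [Submodule.mem_bot, morse, LinearMap.comp_apply, LinearMap.comp_apply, barD_single, h0,
    map_zero, map_zero]

end

section

variable {k : Type*} [Field k]

theorem appendR_letter_mem {n j : ℕ} {W W' : ℤ} (hW : W' + j = W + 1) {x : Bar k}
    (hx : x ∈ critFil k n 2 W') : appendR [j] x ∈ critFil k (n + 1) j W :=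
  appendR_critFil (τ := [j]) (List.isChain_singleton j) (by simp [LastGE]) (by simp)
    (by simp; omega) hx

/-! ### The Anick complex inside the bar complex -/

theorem anickFiltration_eq (n j : ℕ) : anickFiltration k n j =
    Finsupp.supported k k {c : AnickChain | c.1.length = n ∧ LastGE j c.1} := by
  rw [anickFiltration, Finsupp.supported_eq_span_single]
  congr 1
  ext x
  constructor
  · rintro ⟨c, h1, h2, rfl⟩
    exact ⟨c, ⟨h1, h2⟩, rfl⟩
  · rintro ⟨c, ⟨h1, h2⟩, rfl⟩
    exact ⟨c, h1, h2, rfl⟩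

theorem anickComponent_eq (n : ℕ) : anickComponent k n = anickFiltration k n 0 := by
  rw [anickComponent, anickFiltration]
  simp

theorem exists_emb_mem {n j : ℕ} {u : Anick k} (hu : u ∈ anickFiltration k n j) :
    ∃ W, emb k u ∈ critFil k n j W := by
  classical
  rw [anickFiltration_eq] at hu
  obtain ⟨W, hW⟩ := (u.support.image fun c : AnickChain => wt c.1).exists_le
  refine ⟨W, fun c hc => ?_⟩
  obtain ⟨a, ha, rfl⟩ := Finset.mem_image.1 (Finsupp.mapDomain_support hc)
  obtain ⟨h1, h2⟩ := hu ha
  refine ⟨⟨by simpa [AnickChain.cell] using h1, ?_, ?_⟩, a, rfl⟩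
  · rwa [AnickChain.cell, flat_map_letter]
  · rw [AnickChain.cell, flat_map_letter]
    exact hW _ (Finset.mem_image_of_mem _ ha)

theorem proj_mem {n j : ℕ} {W : ℤ} {w : Bar k} (hw : w ∈ critFil k n j W) :
    proj k w ∈ anickFiltration k n j := by
  rw [anickFiltration_eq]
  refine map_supported_le ?_ hw
  rintro _ ⟨⟨h1, h2, -⟩, a, rfl⟩
  rw [proj_single_cell]
  refine Finsupp.single_mem_supported k _ ⟨by simpa [AnickChain.cell] using h1, ?_⟩
  rwa [AnickChain.cell, flat_map_letter] at h2

/-! ### Exactness in the bar complex -/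

variable [CharZero k]

/-- If `[a|j]` plus terms with larger last letters is a cycle, then so is `a`. -/
theorem morse_eq_zero_of_append {n j : ℕ} {W W' : ℤ} (hW : W' + j = W + 1) {a u : Bar k}
    (ha : a ∈ critFil k (n + 1) 2 W') (hu : u ∈ fil k (n + 2) (j + 1) W)
    (h : morse k (appendR [j] a + u) = 0) : morse k a = 0 := by
  have ha' := critFil_le_fil _ _ _ ha
  obtain ⟨y, hy, h1⟩ := exists_morse_append_letter j hW ha'
  have hz := neg_mem (add_mem (critFil_le_fil _ _ _ hy) (critFil_le_fil _ _ _ (morse_mem hu)))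
  refine eq_zero_of_appendR_eq (τ := [j]) (critFil_le_fil _ _ _ (morse_mem ha'))
    (fun c _ => apply_eq_zero_of_fil hz (Nat.lt_succ_self j) [] c) ?_
  rw [map_add, h1, add_assoc] at h
  exact eq_neg_of_add_eq_zero_left h

/-- The differential strictly increases the last letter of a chain `[i|j]`. -/
theorem morse_mem_of_two {j : ℕ} (hj : 1 ≤ j) {W : ℤ} {x : Bar k} (hx : x ∈ critFil k 2 j W) :
    morse k x ∈ critFil k 1 (j + 1) W := by
  refine map_supported_le ?_ hx
  rintro _ ⟨⟨h1, h2, h3⟩, ⟨a, ha⟩, rfl⟩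
  obtain ⟨i, j', rfl⟩ : ∃ i j', a = [i, j'] := by
    rw [← List.length_eq_two]
    simpa [AnickChain.cell] using h1
  have hj' : j ≤ j' := by simpa [AnickChain.cell, LastGE, letter] using h2
  have hi : 2 ≤ i := by
    have := List.isChain_pair.1 ha
    rcases this with h | h <;> omega
  have hs : Finsupp.single [letter i] (1 : k) ∈ fil k 1 2 (W + 1 - j') := by
    refine Finsupp.single_mem_supported k _ ⟨rfl, by simpa [LastGE, letter] using hi, ?_⟩
    simp [AnickChain.cell, letter] at h3 ⊢
    omega
  obtain ⟨y, hy, h⟩ := exists_morse_append_letter (W := W) j' (by ring) hs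
  rw [morse_of_mem_one hs, map_zero, zero_add, appendR_single] at h
  have h' : morse k (Finsupp.single (AnickChain.cell ⟨[i, j'], ha⟩) 1) = y := h
  rw [h']
  exact critFil_mono _ (by omega) _ hy

/-- The induction on the last letter. If `[a|j]` is the part of a cycle with the smallest last
letter, and `a` is the boundary of `b`, then subtracting the boundary of `[b|j]` increases the
smallest last letter. As the weight is bounded, this ends. -/
theorem exact_of_append {n : ℕ} {W : ℤ} {j : ℕ} (hj : 1 ≤ j)
    (h : ∀ j' W', j ≤ j' → W' + (j' : ℤ) = W + 1 → ∀ a ∈ critFil k (n + 1) 2 W',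
      ∀ u ∈ critFil k (n + 2) (j' + 1) W, morse k (appendR [j'] a + u) = 0 →
      ∃ b ∈ critFil k (n + 2) 2 W', morse k b = a)
    {u : Bar k} (hu : u ∈ critFil k (n + 2) j W) (hu0 : morse k u = 0) :
    ∃ w ∈ critFil k (n + 3) j W, morse k w = u := by
  induction hd : (W + 2 - j).toNat generalizing j u with
  | zero =>
    exact ⟨0, zero_mem _, by rw [map_zero, eq_zero_of_mem_critFil hj (by omega) hu]⟩
  | succ d ih =>
    obtain ⟨W', hW⟩ : ∃ W' : ℤ, W' + j = W + 1 := ⟨W + 1 - j, by ring⟩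
    obtain ⟨_, ⟨a, ha, rfl⟩, u', hu', rfl⟩ := Submodule.mem_sup.1 (critFil_le_sup hj hW hu)
    obtain ⟨b, hb, rfl⟩ := h j W' le_rfl hW a ha u' hu' hu0
    obtain ⟨y, hy, hy'⟩ := exists_morse_append_letter j hW (critFil_le_fil _ _ _ hb)
    have hbj := appendR_letter_mem hW hb
    obtain ⟨w, hw, hw'⟩ := ih (j := j + 1) (u := u' - y) (by omega)
      (fun j' W' hj' => h j' W' (by omega)) (sub_mem hu' hy) (by
        have h1 : u' - y = (appendR [j] (morse k b) + u') - morse k (appendR [j] b) := by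
          rw [hy']
          abel
        rw [h1, map_sub, hu0, morse_morse hbj, sub_zero]) (by omega)
    refine ⟨appendR [j] b + w, add_mem hbj (critFil_mono _ (Nat.le_succ j) _ hw), ?_⟩
    rw [map_add, hy', hw']
    abel

/-- Modulo boundaries, each chain `[i]` with `i ≥ 2` is a multiple of `[2]`. -/
theorem exists_eq_add_morse {W : ℤ} {a : Bar k} (ha : a ∈ critFil k 1 2 W) :
    ∃ t : k, ∃ b ∈ critFil k 2 2 W, a = t • Finsupp.single [letter 2] 1 + morse k b := by
  suffices h : a ∈ Submodule.span k {Finsupp.single [letter 2] (1 : k)} ⊔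
      (critFil k 2 2 W).map (morse k) by
    obtain ⟨x, hx, _, ⟨b, hb, rfl⟩, rfl⟩ := Submodule.mem_sup.1 h
    obtain ⟨t, rfl⟩ := Submodule.mem_span_singleton.1 hx
    exact ⟨t, b, hb, rfl⟩
  refine map_supported_le (T := LinearMap.id) ?_ ha
  rintro _ ⟨⟨h1, h2, h3⟩, ⟨a, ha'⟩, rfl⟩
  obtain ⟨i, rfl⟩ : ∃ i, a = [i] := by
    rw [← List.length_eq_one_iff]
    simpa [AnickChain.cell] using h1
  have hi : 2 ≤ i := by simpa [AnickChain.cell, LastGE, letter] using h2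
  have hcell : AnickChain.cell ⟨[i], ha'⟩ = [letter i] := rfl
  rw [LinearMap.id_apply, hcell]
  rw [hcell] at h3
  rcases hi.eq_or_lt with rfl | hi
  · exact Submodule.mem_sup_left (Submodule.mem_span_singleton_self _)
  · obtain ⟨m, rfl⟩ : ∃ m, i = m + 1 := ⟨i - 1, by omega⟩
    obtain ⟨r, hr, h⟩ := morse_two_letter (k := k) m
    refine Submodule.mem_sup_right ⟨r⁻¹ • Finsupp.single [letter 2, letter m] 1,
      Submodule.smul_mem _ _ (Finsupp.single_mem_supported k _
        ⟨⟨rfl, ?_, ?_⟩, ⟨[2, m], by simp [Obstruction]⟩, rfl⟩), ?_⟩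
    · simp [LastGE, letter]
      omega
    · simp [letter] at h3 ⊢
      omega
    · rw [map_smul, h, smul_smul, inv_mul_cancel₀ hr, one_smul]

/-- Exactness of the complex of Anick chains with all letters at least two. -/
theorem exact_two {n : ℕ} {W : ℤ} {u : Bar k} (hu : u ∈ critFil k (n + 2) 2 W)
    (hu0 : morse k u = 0) : ∃ w ∈ critFil k (n + 3) 2 W, morse k w = u := by
  induction n generalizing W u with
  | zero =>
    refine exact_of_append one_le_two (fun j W' hj hW a ha u hu h0 => ?_) hu hu0
    obtain ⟨t, b, hb, rfl⟩ := exists_eq_add_morse ha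
    refine ⟨b, hb, ?_⟩
    obtain ⟨y, hy, hy'⟩ := exists_morse_append_letter j hW (critFil_le_fil _ _ _ hb)
    obtain ⟨r, hr, h2⟩ := morse_two_letter (k := k) j
    -- the cycle `t [2|j] + (u - y)` forces `t = 0`: its boundary is `t r [j+1]` plus larger terms
    have h3 : appendR [j] (t • Finsupp.single [letter 2] 1 + morse k b) + u
        - morse k (appendR [j] b) = t • Finsupp.single [letter 2, letter j] 1 + (u - y) := by
      rw [hy', map_add, map_smul, appendR_single]
      simp only [List.map_singleton, List.singleton_append]
      abel
    have h4 := congrArg (morse k) h3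
    rw [map_sub, h0, morse_morse (appendR_letter_mem hW hb), sub_zero, map_add, map_smul, h2] at h4
    have h5 := morse_mem_of_two (by omega) (sub_mem hu hy)
    have h6 := congrArg (fun x => x [letter (j + 1)]) h4
    have h7 := apply_eq_zero_of_fil (critFil_le_fil _ _ _ h5) (Nat.lt_succ_self (j + 1)) [] []
    simp only [List.nil_append, List.map_singleton] at h7
    simp only [Finsupp.add_apply, Finsupp.smul_apply, Finsupp.single_eq_same, h7,
      Finsupp.zero_apply, smul_eq_mul, mul_one, add_zero] at h6
    have ht : t = 0 := (mul_eq_zero.1 h6.symm).resolve_right hr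
    rw [ht, zero_smul, zero_add]
  | succ n ih =>
    exact exact_of_append one_le_two (fun j W' hj hW a ha u hu h0 =>
      ih ha (morse_eq_zero_of_append hW ha (critFil_le_fil _ _ _ hu) h0)) hu hu0

theorem exact_one {n : ℕ} {W : ℤ} {u : Bar k} (hu : u ∈ critFil k (n + 3) 1 W)
    (hu0 : morse k u = 0) : ∃ w ∈ critFil k (n + 4) 1 W, morse k w = u :=
  exact_of_append le_rfl (fun _ _ _ hW _ ha _ hu h0 =>
    exact_two ha (morse_eq_zero_of_append hW ha (critFil_le_fil _ _ _ hu) h0)) hu hu0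

theorem morse_mem_critRemainder {n : ℕ} {W : ℤ} {x : Bar k}
    (hx : x ∈ critRemainder k (n + 1) W) : morse k x ∈ critRemainder k n W := by
  obtain ⟨y, hy, _, ⟨z, hz, rfl⟩, rfl⟩ := Submodule.mem_sup.1 hx
  have hz' := critFil_le_fil _ _ _ hz
  obtain ⟨r, hr, h⟩ := exists_morse_append_letter (W := W) 0 (by simp) hz'
  rw [map_add, h, add_comm, add_assoc]
  exact add_mem (Submodule.mem_sup_right (Submodule.mem_map_of_mem (morse_mem hz')))
    (Submodule.mem_sup_left (add_mem hr (morse_mem (critFil_le_fil _ _ _ hy))))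

/-- First the terms `[b|1|0]` of a cycle are removed, then the terms `[c|0]` whose remaining letters
are at least two. -/
theorem exact_zero {n : ℕ} {W : ℤ} {u : Bar k} (hu : u ∈ critFil k (n + 4) 0 W)
    (hu0 : morse k u = 0) : ∃ w ∈ critFil k (n + 5) 0 W, morse k w = u := by
  have hch : [1, 0].IsChain Obstruction := by simp [Obstruction]
  have hW : W + 1 + ((0 : ℕ) : ℤ) = W + 1 := by simp
  obtain ⟨_, ⟨b, hb, rfl⟩, v, hv, rfl⟩ := Submodule.mem_sup.1 (critFil_zero_le_sup hu)
  rw [sup_comm] at hv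
  have hbz : morse k b = 0 := by
    have hb' := critFil_le_fil _ _ _ hb
    obtain ⟨y, hy, h⟩ := exists_morse_append_one_zero hb'
    have hz := critRemainder_le_remainder _ _
      (neg_mem (add_mem hy (morse_mem_critRemainder (n := n + 1) hv)))
    refine eq_zero_of_appendR_eq (τ := [1, 0]) (critFil_le_fil _ _ _ (morse_mem hb'))
      (fun c _ => apply_eq_zero_of_remainder hz c) ?_
    rw [map_add, h, add_assoc] at hu0
    exact eq_neg_of_add_eq_zero_left hu0
  obtain ⟨b, hb', rfl⟩ := exact_two hb hbz
  have hb₂ : appendR [1, 0] b ∈ critFil k (n + 5) 0 W :=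
    appendR_critFil hch (by simp [LastGE]) (by simp) (by simp) hb'
  obtain ⟨y, hy, h⟩ := exists_morse_append_one_zero (critFil_le_fil _ _ _ hb')
  obtain ⟨u₁, hu₁, _, ⟨c, hc, rfl⟩, hvy⟩ := Submodule.mem_sup.1 (sub_mem hv hy)
  have hcycle : morse k (appendR [0] c + u₁) = 0 := by
    have h1 : appendR [0] c + u₁ =
        (appendR [1, 0] (morse k b) + v) - morse k (appendR [1, 0] b) := by
      rw [h, add_comm, hvy]
      abel
    rw [h1, map_sub, hu0, morse_morse hb₂, sub_zero]
  obtain ⟨c, hc', rfl⟩ := exact_two hc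
    (morse_eq_zero_of_append hW hc (critFil_le_fil _ _ _ hu₁) hcycle)
  have hc₂ := appendR_letter_mem hW hc'
  obtain ⟨z, hz, h'⟩ := exists_morse_append_letter 0 hW (critFil_le_fil _ _ _ hc')
  obtain ⟨w, hw, hw'⟩ := exact_one (u := u₁ - z) (sub_mem hu₁ hz) (by
    have h1 : u₁ - z = (appendR [0] (morse k c) + u₁) - morse k (appendR [0] c) := by
      rw [h']
      abel
    rw [h1, map_sub, hcycle, morse_morse hc₂, sub_zero])
  refine ⟨appendR [1, 0] b + (appendR [0] c + w),
    add_mem hb₂ (add_mem hc₂ (critFil_mono _ zero_le_one _ hw)), ?_⟩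
  rw [map_add, map_add, h, h', hw']
  have h2 : v = y + (u₁ + appendR [0] (morse k c)) := by
    rw [hvy]
    abel
  rw [h2]
  abel

/-! ### Exactness of the Anick complex -/

theorem anickBoundary_proj {n j : ℕ} {W : ℤ} {w : Bar k} (hw : w ∈ critFil k n j W) :
    anickBoundary k (proj k w) = proj k (morse k w) := by
  have h := morse_emb (proj k w)
  rw [show emb k (proj k w) = w from crit_of_mem hw] at h
  rw [h, proj_emb]

theorem anickBoundary_mem {n j : ℕ} {u : Anick k} (hu : u ∈ anickFiltration k (n + 1) j) :
    anickBoundary k u ∈ anickFiltration k n j := by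
  obtain ⟨W, hW⟩ := exists_emb_mem hu
  rw [← proj_emb k (anickBoundary k u), ← morse_emb]
  exact proj_mem (morse_mem (critFil_le_fil _ _ _ hW))

/-- Exactness in the bar complex implies exactness in the Anick complex. -/
theorem exists_anickBoundary_eq {n j : ℕ}
    (h : ∀ W : ℤ, ∀ x ∈ critFil k n j W, morse k x = 0 → ∃ w ∈ critFil k (n + 1) j W, morse k w = x)
    {u : Anick k} (hu : u ∈ anickFiltration k n j) (hu0 : anickBoundary k u = 0) :
    ∃ w ∈ anickFiltration k (n + 1) j, anickBoundary k w = u := by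
  obtain ⟨W, hW⟩ := exists_emb_mem hu
  obtain ⟨w, hw, hwu⟩ := h W _ hW (by rw [morse_emb, hu0, map_zero])
  exact ⟨proj k w, proj_mem hw, by rw [anickBoundary_proj hw, hwu, proj_emb]⟩

end

end U3

theorem mainTheorem6 (k : Type*) [Field k] [CharZero k] :
    (∀ n : ℕ, 2 ≤ n → ∀ u ∈ U3.anickFiltration k n 2, U3.anickBoundary k u = 0 →
      ∃ w ∈ U3.anickFiltration k (n + 1) 2, U3.anickBoundary k w = u) ∧
    (∀ n : ℕ, 3 ≤ n → ∀ u ∈ U3.anickFiltration k n 1, U3.anickBoundary k u = 0 →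
      ∃ w ∈ U3.anickFiltration k (n + 1) 1, U3.anickBoundary k w = u) ∧
    (∀ n : ℕ, 4 ≤ n →
      (U3.anickComponent k (n + 1)).map (U3.anickBoundary k) =
        U3.anickComponent k n ⊓ LinearMap.ker (U3.anickBoundary k)) := by
  refine ⟨fun n hn u hu hu0 => ?_, fun n hn u hu hu0 => ?_, fun n hn => ?_⟩
  · obtain ⟨n, rfl⟩ := Nat.exists_eq_add_of_le' hn
    exact U3.exists_anickBoundary_eq (fun _ _ => U3.exact_two) hu hu0
  · obtain ⟨n, rfl⟩ := Nat.exists_eq_add_of_le' hn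
    exact U3.exists_anickBoundary_eq (fun _ _ => U3.exact_one) hu hu0
  · obtain ⟨n, rfl⟩ := Nat.exists_eq_add_of_le' hn
    rw [U3.anickComponent_eq, U3.anickComponent_eq]
    refine le_antisymm ?_ ?_
    · rintro _ ⟨w, hw, rfl⟩
      exact ⟨U3.anickBoundary_mem hw, U3.anickBoundary_anickBoundary k w⟩
    · rintro u ⟨hu, hu0⟩
      exact U3.exists_anickBoundary_eq (fun _ _ => U3.exact_zero) hu hu0
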